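/- **Setting.** Let $\mathcal V$ be a finite vocabulary and $N,L,T\ge 1$ integers. The data are $N$ sequences $x_i=(x_{i,1},\dots,x_{i,T+1})$ of tokens in $\mathcal V$. $X_i,Y_i\in\mathbb R^{T\times|\mathcal V|}$ are the one-hot matrices of $(x_{i,1},\dots,x_{i,T})$ and $(x_{i,2},\dots,x_{i,T+1})$. The parameters $\Theta$ are $W_O\in\mathbb R^{|\mathcal V|\times|\mathcal V|}$ and, for $1\le l\le L$, $W^{(l)},V^{(l)}\in\mathbb R^{|\mathcal V|\times|\mathcal V|}$ and $P^{(l)}\in\mathbb R^T$. The model is $F_\Theta(X)=h^{(L)}W_O$ with $h^{(0)}=X$ and $$h^{(l)}=h^{(l-1)}+\mathcal S\big(\mathrm{Mask}(h^{(l-1)}W^{(l)}h^{(l-1)\top}+\mathrm{DM}(P^{(l)}))\big)\,h^{(l-1)}V^{(l)},$$ where $\mathcal S$ is the row-wise softmax, $\mathrm{Mask}$ is the causal mask (row $t$ keeps columns $k\le t$, the other entries become $-\infty$), and $\mathrm{DM}(P)_{tk}=P_{t-k+1}$ for $k\le t$. The loss is $$\mathcal L(\Theta)=-\frac1{NT}\sum_{i=1}^N\sum_{t=1}^T\log\mathcal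 S(F_\Theta(X_i))_{t,\,x_{i,t+1}},$$ and gradient descent with learning rate $\eta>0$ is $\Theta\leftarrow\Theta-\eta\nabla\mathcal L(\Theta)$, jointly in all parameters. **Statistics.** Let $\mathcal P(a)$ be the relative frequency of the token $a$ among the $NT$ input tokens $x_{i,t}$, $1\le t\le T$, let $\mathcal P(b\mid a)$ be the relative frequency of $b$ as next token given the current token $a$ (with $\mathcal P(a)\mathcal P(b\mid a)=0$ if $a$ does not occur among the input tokens), and let $$\bar B_{ab}=\mathcal P(a)\mathcal P(b\mid a)-\frac{\mathcal P(a)}{|\mathcal V|},\qquad \bar\Phi_{ab}=\frac1T\sum_{k=1}^T\frac1k\sum_{m=1}^k\frac{\#\{i:x_{i,k+1}=a,\ x_{i,m}=b\}}{N}-\mu_b,$$ where $\mu_b$ makes each column of $\bar\Phi$ sum to $0$. Let $A_0\in\mathbb R^{T\times T}$ be the uniform causal attention, $(A_0)_{tk}=1/t$ for $k\le t$ and $0$ otherwise, let $J_t=\mathrm{Diag}((A_0)_{t,:})-(A_0)_{t,:}^\top(A_0)_{t,:}$, and let $U_O\in\mathbb R^{T\times|\mathcal V|}$ have all entries $1/|\mathcal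 V|$. Let $$M_i=(Y_i-U_O)\,\bar B^\top\bar B\,\bar\Phi X_i^\top,\quad (Q_i)_{tj}=\sum_{k=1}^T(J_t)_{jk}(M_i)_{tk},\quad \bar Q=\frac1{NT}\sum_{i=1}^N X_i^\top Q_iX_i,\quad \Delta_m=\frac1{NT}\sum_{i=1}^N\sum_{t=m}^{T}(Q_i)_{t,\,t-m+1}\ (1\le m\le T).$$ **Theorem.** Let $N\ge1$, $1\le L\le\sqrt T/4$, $T\ge60$, $|\mathcal V|\ge500$, $\eta>0$, and let all parameters be initialised at $0$. Let $s\ge0$ be an integer with $$s\le\eta^{-1}\min\Big(\frac1{12L},\frac5{8\sqrt T}\Big).$$ Then after $s$ gradient descent steps with learning rate $\eta$, $$\|W_O-s\eta\bar B\|_F\le3s^2\eta^2,$$ and for every layer $1\le l\le L$, $$\Big\|V^{(l)}-\binom s2\eta^2\,\bar\Phi^\top\bar B^\top\Big\|_F\le12s^3\eta^3,$$ $$\Big\|W^{(l)}-\Big(3\binom s4+2\binom s3\Big)\eta^4\bar Q\Big\|_F\le13s^5\eta^5T,$$ $$\Big\|P^{(l)}-\Big(3\binom s4+2\binom s3\Big)\eta^4\Delta\Big\|_F\le13s^5\eta^5T,$$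 where $\|\cdot\|_F$ is the Frobenius norm (for the vectors $P^{(l)}$, the Euclidean norm). -/

import Mathlib

open scoped Matrix Matrix.Norms.Frobenius

namespace EarlyFeatures

noncomputable section

/-! ### The model -/

/-- Softmax of the scores `z` restricted to the unmasked positions `S`: masked positions carry the
score `-∞`, hence weight `0`. -/
def softmaxOn {ι : Type*} [DecidableEq ι] (S : Finset ι) (z : ι → ℝ) (i : ι) : ℝ :=
  if i ∈ S then Real.exp (z i) / ∑ j ∈ S, Real.exp (z j) else 0

/-- The usual softmax. -/
def softmax {ι : Type*} [Fintype ι] [DecidableEq ι] (z : ι → ℝ) : ι → ℝ :=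
  softmaxOn Finset.univ z

/-- Row-wise softmax of the causally masked score matrix: row `t` only sees columns `k ≤ t`. -/
def causalSoftmax {T : ℕ} (Z : Matrix (Fin T) (Fin T) ℝ) : Matrix (Fin T) (Fin T) ℝ :=
  Matrix.of fun t k => softmaxOn (Finset.Iic t) (Z t) k

/-- The map `DM`: entry number `m = 0, 1, …` of the vector `p` is placed on the `m`-th
subdiagonal (`m = 0` being the main diagonal). -/
def DM {T : ℕ} (p : EuclideanSpace ℝ (Fin T)) : Matrix (Fin T) (Fin T) ℝ :=
  Matrix.of fun t k => if k ≤ t then p ⟨t.val - k.val, by omega⟩ else 0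

/-- Indices of the scalar parameters: the entries of the `W⁽ˡ⁾`, the `P⁽ˡ⁾`, the `V⁽ˡ⁾`,
and of `W_O`, in this order. -/
abbrev ParamIdx (𝒱 : Type*) (L T : ℕ) : Type _ :=
  (Fin L × 𝒱 × 𝒱) ⊕ (Fin L × Fin T) ⊕ (Fin L × 𝒱 × 𝒱) ⊕ (𝒱 × 𝒱)

/-- The space of all parameters, with the Euclidean structure that defines the gradient. -/
abbrev Params (𝒱 : Type*) (L T : ℕ) : Type _ := EuclideanSpace ℝ (ParamIdx 𝒱 L T)

namespace Params

variable {𝒱 : Type*} {L T : ℕ}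

/-- The key-query matrix `W⁽ˡ⁾`. -/
def keyQuery (θ : Params 𝒱 L T) (l : Fin L) : Matrix 𝒱 𝒱 ℝ :=
  Matrix.of fun a b => θ (Sum.inl (l, a, b))

/-- The relative positional encoding `P⁽ˡ⁾`. -/
def posEnc (θ : Params 𝒱 L T) (l : Fin L) : EuclideanSpace ℝ (Fin T) :=
  WithLp.toLp 2 fun m => θ (Sum.inr (Sum.inl (l, m)))

/-- The value matrix `V⁽ˡ⁾`. -/
def value (θ : Params 𝒱 L T) (l : Fin L) : Matrix 𝒱 𝒱 ℝ :=
  Matrix.of fun a b => θ (Sum.inr (Sum.inr (Sum.inl (l, a, b))))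

/-- The output matrix `W_O`. -/
def output (θ : Params 𝒱 L T) : Matrix 𝒱 𝒱 ℝ :=
  Matrix.of fun a b => θ (Sum.inr (Sum.inr (Sum.inr (a, b))))

end Params

section Model

variable {𝒱 : Type*} [Fintype 𝒱] {L T : ℕ}

/-- The attention pattern of a layer with parameters `W`, `p` on the hidden state `h`. -/
def attention (W : Matrix 𝒱 𝒱 ℝ) (p : EuclideanSpace ℝ (Fin T)) (h : Matrix (Fin T) 𝒱 ℝ) :
    Matrix (Fin T) (Fin T) ℝ :=
  causalSoftmax (h * W * hᵀ + DM p)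

/-- The hidden states `h⁽⁰⁾, …, h⁽ᴸ⁾`. The layer `l : Fin L` maps the state number `l.castSucc`
to the state number `l.succ`. -/
def hiddenState (θ : Params 𝒱 L T) (X : Matrix (Fin T) 𝒱 ℝ) : Fin (L + 1) → Matrix (Fin T) 𝒱 ℝ :=
  Fin.induction (motive := fun _ => Matrix (Fin T) 𝒱 ℝ) X
    fun l h => h + attention (θ.keyQuery l) (θ.posEnc l) h * h * θ.value l

/-- The `L`-layer attention-based transformer. -/
def transformer (θ : Params 𝒱 L T) (X : Matrix (Fin T) 𝒱 ℝ) : Matrix (Fin T) 𝒱 ℝ :=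
  hiddenState θ X (Fin.last L) * θ.output

end Model

/-! ### Data, loss and gradient descent

A data set consists of `N` sequences of `T + 1` tokens; the first `T` tokens are the input and the
last `T` tokens are the targets. -/

section Training

variable {𝒱 : Type*} [Fintype 𝒱] [DecidableEq 𝒱] {N L T : ℕ}

/-- The one-hot input matrix of a sequence. -/
def inputMatrix (x : Fin (T + 1) → 𝒱) : Matrix (Fin T) 𝒱 ℝ :=
  Matrix.of fun t a => if x t.castSucc = a then 1 else 0

/-- The one-hot matrix of next tokens of a sequence. -/
def targetMatrix (x : Fin (T + 1) → 𝒱) : Matrix (Fin T) 𝒱 ℝ :=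
  Matrix.of fun t a => if x t.succ = a then 1 else 0

/-- The cross-entropy loss, averaged over the `N` sequences and the `T` positions. -/
def loss (x : Fin N → Fin (T + 1) → 𝒱) (θ : Params 𝒱 L T) : ℝ :=
  -1 / ((N : ℝ) * T) * ∑ i, ∑ t,
    (fun a => Real.log (softmax (transformer θ (inputMatrix (x i)) t) a)) ⬝ᵥ
      targetMatrix (x i) t

end Training

/-- The iterates of gradient descent with constant learning rate `η` from `θ₀`. -/
def gradientDescent {E : Type*} [NormedAddCommGroup E] [InnerProductSpace ℝ E] [CompleteSpace E]
    (f : E → ℝ) (η : ℝ) (θ₀ : E) : ℕ → E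
  | 0 => θ₀
  | k + 1 => gradientDescent f η θ₀ k - η • gradient f (gradientDescent f η θ₀ k)

/-! ### Corpus statistics -/

section Statistics

variable {𝒱 : Type*} [Fintype 𝒱] [DecidableEq 𝒱] {N T : ℕ}

/-- The relative frequency of the token `a` among all input tokens. -/
def tokenFreq (x : Fin N → Fin (T + 1) → 𝒱) (a : 𝒱) : ℝ :=
  ((Finset.univ.filter fun q : Fin N × Fin T => x q.1 q.2.castSucc = a).card : ℝ) / ((N : ℝ) * T)

/-- The relative frequency of the token `b` as next token, given that the current token is `a`
(with the value `0` if `a` does not occur as an input token). -/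
def nextFreq (x : Fin N → Fin (T + 1) → 𝒱) (a b : 𝒱) : ℝ :=
  ((Finset.univ.filter fun q : Fin N × Fin T =>
      x q.1 q.2.castSucc = a ∧ x q.1 q.2.succ = b).card : ℝ) /
    ((Finset.univ.filter fun q : Fin N × Fin T => x q.1 q.2.castSucc = a).card : ℝ)

/-- The row-centred bigram matrix `B̄`. -/
def bigramBar (x : Fin N → Fin (T + 1) → 𝒱) : Matrix 𝒱 𝒱 ℝ :=
  Matrix.of fun a b =>
    tokenFreq x a * nextFreq x a b - tokenFreq x a / (Fintype.card 𝒱 : ℝ)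

/-- The empirical probability that the token at position `p` is `a` and the token at position `q`
is `b`. -/
def jointProb (x : Fin N → Fin (T + 1) → 𝒱) (p q : Fin (T + 1)) (a b : 𝒱) : ℝ :=
  ((Finset.univ.filter fun i : Fin N => x i p = a ∧ x i q = b).card : ℝ) / (N : ℝ)

/-- The uncentred context matrix: the entry `(a, b)` measures how often `b` is in the prefix
of `a`. -/
def context (x : Fin N → Fin (T + 1) → 𝒱) : Matrix 𝒱 𝒱 ℝ :=
  Matrix.of fun a b => 1 / (T : ℝ) * ∑ k : Fin T,
    1 / ((k : ℝ) + 1) * ∑ m ∈ Finset.Iic k, jointProb x k.succ m.castSucc a b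

/-- The context matrix `Φ̄`, centred such that each column sums to zero. -/
def contextBar (x : Fin N → Fin (T + 1) → 𝒱) : Matrix 𝒱 𝒱 ℝ :=
  Matrix.of fun a b => context x a b - (∑ c, context x c b) / (Fintype.card 𝒱 : ℝ)

/-- The interchangeability matrix `Σ = B̄ᵀ B̄`. -/
def interchange (x : Fin N → Fin (T + 1) → 𝒱) : Matrix 𝒱 𝒱 ℝ :=
  (bigramBar x)ᵀ * bigramBar x

/-- The uniform causal attention `A₀`. -/
def uniformAttention (T : ℕ) : Matrix (Fin T) (Fin T) ℝ :=
  Matrix.of fun t k => if k ≤ t then 1 / ((t : ℝ) + 1) else 0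

/-- The softmax Jacobian `J_t = Diag(a) - aᵀ a` at the row `a` number `t` of `A₀`. -/
def uniformJacobian (T : ℕ) (t : Fin T) : Matrix (Fin T) (Fin T) ℝ :=
  Matrix.diagonal (uniformAttention T t) -
    Matrix.vecMulVec (uniformAttention T t) (uniformAttention T t)

/-- The matrix `U_O` all of whose entries are `1 / |𝒱|`. -/
def uniformOutput (𝒱 : Type*) [Fintype 𝒱] (T : ℕ) : Matrix (Fin T) 𝒱 ℝ :=
  Matrix.of fun _ _ => 1 / (Fintype.card 𝒱 : ℝ)

/-- The scores `(Y_i - U_O) Σ Φ̄ X_iᵀ` between output and input positions of sample `i`. -/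
def scores (x : Fin N → Fin (T + 1) → 𝒱) (i : Fin N) : Matrix (Fin T) (Fin T) ℝ :=
  (targetMatrix (x i) - uniformOutput 𝒱 T) * interchange x * contextBar x *
    (inputMatrix (x i))ᵀ

/-- The per-sample correlation matrix `Q_i`: its row `t` is `J_t` applied to the row `t` of the
scores. -/
def corr (x : Fin N → Fin (T + 1) → 𝒱) (i : Fin N) : Matrix (Fin T) (Fin T) ℝ :=
  Matrix.of fun t j => ∑ k, uniformJacobian T t j k * scores x i t k

/-- The token-to-token correlation `Q̄`. -/
def corrBar (x : Fin N → Fin (T + 1) → 𝒱) : Matrix 𝒱 𝒱 ℝ :=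
  (1 / ((N : ℝ) * T)) • ∑ i, (inputMatrix (x i))ᵀ * corr x i * inputMatrix (x i)

/-- The relative-position correlation `Δ`: entry `m` is the sum along the `m`-th subdiagonal
(`m = 0` being the main diagonal) of the average of the `Q_i`. -/
def posCorr (x : Fin N → Fin (T + 1) → 𝒱) : EuclideanSpace ℝ (Fin T) :=
  WithLp.toLp 2 fun m => 1 / ((N : ℝ) * T) *
    ∑ i, ∑ t : Fin T, ∑ k : Fin T, if t.val = k.val + m.val then corr x i t k else 0

end Statistics

end

end EarlyFeatures

/-! Write D = kη for the training time after k steps. The blocks of parameters switch on one after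
another. The gradient in W_O is nonzero already at the origin, so W_O grows like D; the gradient in
V carries a factor W_O, so V grows like D²; the gradients in W and P carry the factors V and W_O, so
these blocks grow like D⁴. To leading order the negative gradients are B̄ for W_O, kη · Φ̄ᵀB̄ᵀ for
V, and kη · C(k,2)η² times Q̄ or Δ for W and P. Summing them over the steps k < s produces s, C(s,2)
and ∑ k·C(k,2) = 3·C(s,4) + 2·C(s,3).

The proof is an induction on the number of steps with the invariant `NearLeading`, whose remainders
are 2D², 4D³, 13D⁵ and 13D⁵. As long as D and LD are at most 1/12, it implies the crude sizes
`SmallParams`. Under these, row by row, the hidden states are within D/6 of X, the attention within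
D/100 of A₀, the residual within 3D of Y - U_O, and a tangent created in one layer reaches the last
state with relative change at most D/3.

The gradient is accessed only through directional derivatives: by `inner_gradient_loss` these are
averages of residual rows against tangent rows of the logits. Replacing every factor by its leading
term costs the errors in `inner_gradient_output`, `inner_gradient_value` and
`inner_gradient_attention`. The remaining leading pairings are exactly the corpus statistics
(`frobInner_bigramBar`, `frobInner_context_bigram`, `frobInner_corrBar`, `sum_posCorr_mul`), so
testing against all directions bounds the gradient errors by 4D, 12D² and 65D⁴. These are the
derivatives of 2D², 4D³ and 13D⁵, which is why the induction closes in `NearLeading.step`.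

All sizes are measured by the largest Euclidean norm of a row. Attention has rows of ℓ¹-norm at most
1 and does not increase it; a parameter matrix multiplies it by at most its Frobenius norm. Hence no
constant depends on T or |𝒱|, and the depth enters only through LD. -/

open scoped Matrix Matrix.Norms.Frobenius

namespace EarlyFeatures

noncomputable section

/-! ### Euclidean norms of rows -/

section Rows

variable {ι κ τ σ ρ : Type*} [Fintype ι] [Fintype κ] [Fintype σ]

/-- The Euclidean norm of a plain vector. -/
def l2 (v : ι → ℝ) : ℝ := ‖WithLp.toLp 2 v‖

theorem l2_nonneg (v : ι → ℝ) : 0 ≤ l2 v := norm_nonneg _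

theorem l2_sq (v : ι → ℝ) : l2 v ^ 2 = ∑ i, v i ^ 2 := by
  rw [l2, EuclideanSpace.norm_sq_eq]
  simp

theorem l2_add_le (v w : ι → ℝ) : l2 (v + w) ≤ l2 v + l2 w := by
  simpa only [l2, WithLp.toLp_add] using norm_add_le (WithLp.toLp 2 v) (WithLp.toLp 2 w)

theorem l2_smul (c : ℝ) (v : ι → ℝ) : l2 (c • v) = |c| * l2 v := by
  simp only [l2, WithLp.toLp_smul, norm_smul, Real.norm_eq_abs]

theorem l2_neg (v : ι → ℝ) : l2 (-v) = l2 v := by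
  simpa using l2_smul (-1) v

theorem l2_sub_le (v w : ι → ℝ) : l2 (v - w) ≤ l2 v + l2 w := by
  simpa only [sub_eq_add_neg, l2_neg] using l2_add_le v (-w)

theorem l2_zero : l2 (0 : ι → ℝ) = 0 := by simp [l2]

theorem abs_le_l2 (v : ι → ℝ) (i : ι) : |v i| ≤ l2 v := by
  refine abs_le_of_sq_le_sq ?_ (l2_nonneg v)
  rw [l2_sq]
  exact Finset.single_le_sum (f := fun j => v j ^ 2) (fun j _ => sq_nonneg _) (Finset.mem_univ i)

theorem l2_le_sum_abs (v : ι → ℝ) : l2 v ≤ ∑ i, |v i| := by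
  refine le_of_sq_le_sq ?_ (Finset.sum_nonneg fun i _ => abs_nonneg _)
  rw [l2_sq]
  simpa only [sq_abs] using
    Finset.sum_sq_le_sq_sum_of_nonneg (s := Finset.univ) (f := fun i => |v i|)
      (fun i _ => abs_nonneg _)

theorem abs_dotProduct_le (v w : ι → ℝ) : |v ⬝ᵥ w| ≤ l2 v * l2 w := by
  have h := abs_real_inner_le_norm (WithLp.toLp 2 w) (WithLp.toLp 2 v)
  rw [EuclideanSpace.inner_eq_star_dotProduct] at h
  simpa [l2, mul_comm] using h

/-- Submultiplicativity of the Frobenius norm, applied to `v` as a matrix with one row. -/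
theorem l2_vecMul_le (v : ι → ℝ) (W : Matrix ι κ ℝ) : l2 (v ᵥ* W) ≤ l2 v * ‖W‖ := by
  have h := Matrix.frobenius_norm_mul (Matrix.replicateRow Unit v) W
  rwa [← Matrix.replicateRow_vecMul, Matrix.frobenius_norm_replicateRow,
    Matrix.frobenius_norm_replicateRow] at h

theorem l2_sum_smul_le {c : ℝ} (a : σ → ℝ) (v : σ → ι → ℝ) (hv : ∀ k, l2 (v k) ≤ c) :
    l2 (∑ k, a k • v k) ≤ (∑ k, |a k|) * c := by
  have h : l2 (∑ k, a k • v k) ≤ ∑ k, l2 (a k • v k) := by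
    simpa only [l2, WithLp.toLp_sum] using
      norm_sum_le Finset.univ fun k => WithLp.toLp 2 (a k • v k)
  refine h.trans ?_
  rw [Finset.sum_mul]
  refine Finset.sum_le_sum fun k _ => ?_
  rw [l2_smul]
  exact mul_le_mul_of_nonneg_left (hv k) (abs_nonneg _)

/-- All rows of `M` have Euclidean norm at most `c`. -/
def RowBound (M : Matrix τ ι ℝ) (c : ℝ) : Prop := ∀ t, l2 (M t) ≤ c

/-- All rows of `A` have `ℓ¹`-norm at most `a`. -/
def RowSumBound (A : Matrix τ σ ℝ) (a : ℝ) : Prop := ∀ t, ∑ k, |A t k| ≤ a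

/-- All entries of `Z` are at most `e` in absolute value. -/
def EntryBound (Z : Matrix τ ρ ℝ) (e : ℝ) : Prop := ∀ t k, |Z t k| ≤ e

theorem RowBound.mono {M : Matrix τ ι ℝ} {c d : ℝ} (h : RowBound M c) (hcd : c ≤ d) :
    RowBound M d := fun t => (h t).trans hcd

theorem RowSumBound.mono {M : Matrix τ σ ℝ} {c d : ℝ} (h : RowSumBound M c) (hcd : c ≤ d) :
    RowSumBound M d := fun t => (h t).trans hcd

theorem EntryBound.mono {M : Matrix τ ρ ℝ} {c d : ℝ} (h : EntryBound M c) (hcd : c ≤ d) :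
    EntryBound M d := fun t k => (h t k).trans hcd

theorem RowBound.zero : RowBound (0 : Matrix τ ι ℝ) 0 := fun _ => l2_zero.le

theorem RowBound.add {M N : Matrix τ ι ℝ} {c d : ℝ} (hM : RowBound M c) (hN : RowBound N d) :
    RowBound (M + N) (c + d) := fun t => (l2_add_le _ _).trans (add_le_add (hM t) (hN t))

theorem RowBound.mul_right {M : Matrix τ ι ℝ} {c d : ℝ} (hM : RowBound M c) {W : Matrix ι κ ℝ}
    (hW : ‖W‖ ≤ d) (hc : 0 ≤ c) : RowBound (M * W) (c * d) := fun t =>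
  (l2_vecMul_le (M t) W).trans (mul_le_mul (hM t) hW (norm_nonneg _) hc)

/-- Each row of the product is a combination of rows of `M` with coefficients of ℓ¹-norm at most
`a`; the number of rows plays no role. -/
theorem RowBound.mul_left {A : Matrix τ σ ℝ} {M : Matrix σ ι ℝ} {a c : ℝ} (hA : RowSumBound A a)
    (hM : RowBound M c) (hc : 0 ≤ c) : RowBound (A * M) (a * c) := fun t => by
  have h : (A * M) t = ∑ k, A t k • M k := by
    ext j
    simp [Matrix.mul_apply]
  rw [h]
  exact (l2_sum_smul_le _ _ hM).trans (mul_le_mul_of_nonneg_right (hA t) hc)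

theorem EntryBound.add {M N : Matrix τ ρ ℝ} {c d : ℝ} (hM : EntryBound M c)
    (hN : EntryBound N d) : EntryBound (M + N) (c + d) :=
  fun t k => (abs_add_le _ _).trans (add_le_add (hM t k) (hN t k))

theorem EntryBound.mul_transpose {M : Matrix τ ι ℝ} {N : Matrix ρ ι ℝ} {c d : ℝ}
    (hM : RowBound M c) (hN : RowBound N d) (hc : 0 ≤ c) : EntryBound (M * Nᵀ) (c * d) := by
  intro t k
  have h : (M * Nᵀ) t k = M t ⬝ᵥ N k := rfl
  rw [h]
  exact (abs_dotProduct_le _ _).trans (mul_le_mul (hM t) (hN k) (l2_nonneg _) hc)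

/-! ### The Frobenius inner product -/

/-- The Frobenius inner product of two real matrices. -/
def frobInner (M N : Matrix ι κ ℝ) : ℝ := ∑ a, ∑ b, M a b * N a b

theorem norm_sq_eq_frobInner (M : Matrix ι κ ℝ) : ‖M‖ ^ 2 = frobInner M M := by
  have h0 : 0 ≤ ∑ i, ∑ j, ‖M i j‖ ^ 2 := by positivity
  rw [Matrix.frobenius_norm_def]
  simp only [Real.rpow_ofNat] at *
  rw [← Real.sqrt_eq_rpow, Real.sq_sqrt h0]
  simp [frobInner, sq]

theorem frobInner_sub_left (M M' N : Matrix ι κ ℝ) :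
    frobInner (M - M') N = frobInner M N - frobInner M' N := by
  simp only [frobInner, Matrix.sub_apply, sub_mul, Finset.sum_sub_distrib]

theorem frobInner_neg_left (M N : Matrix ι κ ℝ) : frobInner (-M) N = -frobInner M N := by
  simp only [frobInner, Matrix.neg_apply, neg_mul, Finset.sum_neg_distrib]

theorem frobInner_smul_left (c : ℝ) (M N : Matrix ι κ ℝ) :
    frobInner (c • M) N = c * frobInner M N := by
  simp only [frobInner, Matrix.smul_apply, smul_eq_mul, mul_assoc, Finset.mul_sum]

/-- Duality, by testing with `M` itself. This converts bounds on directional derivatives into bounds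
on blocks of the gradient. -/
theorem norm_le_of_frobInner_le {M : Matrix ι κ ℝ} {c : ℝ} (hc : 0 ≤ c)
    (h : ∀ δ : Matrix ι κ ℝ, frobInner M δ ≤ c * ‖δ‖) : ‖M‖ ≤ c := by
  by_contra! hlt
  have h1 := h M
  rw [← norm_sq_eq_frobInner] at h1
  nlinarith

theorem norm_le_of_dotProduct_le {p : EuclideanSpace ℝ ι} {c : ℝ} (hc : 0 ≤ c)
    (h : ∀ δ : EuclideanSpace ℝ ι, ∑ i, p i * δ i ≤ c * ‖δ‖) : ‖p‖ ≤ c := by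
  by_contra! hlt
  have h1 := h p
  have h2 : ‖p‖ ^ 2 = ∑ i, p i * p i := by
    rw [EuclideanSpace.norm_sq_eq]
    simp [sq]
  rw [← h2] at h1
  nlinarith

end Rows

/-! ### Averages over samples and positions -/

section Average

variable {ι : Type*} [Fintype ι] {N T : ℕ}

/-- The average over samples and positions of the inner products of rows. -/
def meanPairing (G M : Fin N → Matrix (Fin T) ι ℝ) : ℝ :=
  1 / ((N : ℝ) * T) * ∑ i, ∑ t, G i t ⬝ᵥ M i t

theorem abs_meanPairing_le {G M : Fin N → Matrix (Fin T) ι ℝ} {g m : ℝ}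
    (hg : 0 ≤ g) (hm : 0 ≤ m) (hG : ∀ i, RowBound (G i) g) (hM : ∀ i, RowBound (M i) m) :
    |meanPairing G M| ≤ g * m := by
  have h : |∑ i, ∑ t, G i t ⬝ᵥ M i t| ≤ ((N : ℝ) * T) * (g * m) := by
    calc |∑ i, ∑ t, G i t ⬝ᵥ M i t| ≤ ∑ i, ∑ t, |G i t ⬝ᵥ M i t| :=
          (Finset.abs_sum_le_sum_abs _ _).trans
            (Finset.sum_le_sum fun i _ => Finset.abs_sum_le_sum_abs _ _)
      _ ≤ ∑ _i : Fin N, ∑ _t : Fin T, g * m :=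
          Finset.sum_le_sum fun i _ => Finset.sum_le_sum fun t _ =>
            (abs_dotProduct_le _ _).trans (mul_le_mul (hG i t) (hM i t) (l2_nonneg _) hg)
      _ = ((N : ℝ) * T) * (g * m) := by simp [mul_assoc]
  rw [meanPairing, abs_mul]
  have hpos : 0 ≤ (N : ℝ) * T := by positivity
  rw [abs_of_nonneg (by positivity)]
  -- For an empty average the prefactor is 1 / 0 = 0, so the bound still holds.
  rcases hpos.eq_or_lt with h0 | h0
  · rw [← h0]
    simpa using mul_nonneg hg hm
  · rw [div_mul_eq_mul_div, one_mul, div_le_iff₀ h0]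
    linarith

theorem meanPairing_sub_left (G G' M : Fin N → Matrix (Fin T) ι ℝ) :
    meanPairing (fun i => G i - G' i) M = meanPairing G M - meanPairing G' M := by
  simp only [meanPairing, ← mul_sub, ← Finset.sum_sub_distrib, ← sub_dotProduct]
  rfl

theorem meanPairing_sub_right (G M M' : Fin N → Matrix (Fin T) ι ℝ) :
    meanPairing G (fun i => M i - M' i) = meanPairing G M - meanPairing G M' := by
  simp only [meanPairing, ← mul_sub, ← Finset.sum_sub_distrib, ← dotProduct_sub]
  rfl

theorem meanPairing_smul_right (c : ℝ) (G M : Fin N → Matrix (Fin T) ι ℝ) :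
    meanPairing G (fun i => c • M i) = c * meanPairing G M := by
  have h : ∀ i t, G i t ⬝ᵥ (c • M i) t = c * (G i t ⬝ᵥ M i t) := fun i t => dotProduct_smul c _ _
  simp only [meanPairing, h, ← Finset.mul_sum]
  ring

/-- Moving the difference of two pairings to the two arguments. -/
theorem abs_meanPairing_sub_le {G G' M M' : Fin N → Matrix (Fin T) ι ℝ} {g m e f : ℝ}
    (hg : 0 ≤ g) (hm : 0 ≤ m) (he : 0 ≤ e) (hf : 0 ≤ f)
    (hG : ∀ i, RowBound (G i - G' i) g) (hM : ∀ i, RowBound (M i) m)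
    (hG' : ∀ i, RowBound (G' i) e) (hM' : ∀ i, RowBound (M i - M' i) f) :
    |meanPairing G M - meanPairing G' M'| ≤ g * m + e * f := by
  have h1 := abs_meanPairing_le hg hm hG hM
  have h2 := abs_meanPairing_le he hf hG' hM'
  rw [meanPairing_sub_left] at h1
  rw [meanPairing_sub_right] at h2
  calc _ = |(meanPairing G M - meanPairing G' M) + (meanPairing G' M - meanPairing G' M')| := by
        ring_nf
    _ ≤ _ := (abs_add_le _ _).trans (add_le_add h1 h2)

end Average

/-! ### The softmax and its Jacobian -/

section Softmax

variable {ι : Type*}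

theorem sum_exp_pos {S : Finset ι} (hS : S.Nonempty) (z : ι → ℝ) :
    0 < ∑ j ∈ S, Real.exp (z j) := Finset.sum_pos (fun _ _ => Real.exp_pos _) hS

theorem abs_dotProduct_le_of_sum_abs [Fintype ι] {a z : ι → ℝ} {c e : ℝ} (ha : ∑ k, |a k| ≤ c)
    (hz : ∀ k, |z k| ≤ e) (he : 0 ≤ e) : |a ⬝ᵥ z| ≤ c * e := by
  calc |a ⬝ᵥ z| ≤ ∑ k, |a k * z k| := Finset.abs_sum_le_sum_abs _ _
    _ ≤ ∑ k, |a k| * e := Finset.sum_le_sum fun k _ => by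
        rw [abs_mul]
        exact mul_le_mul_of_nonneg_left (hz k) (abs_nonneg _)
    _ ≤ c * e := by
        rw [← Finset.sum_mul]
        exact mul_le_mul_of_nonneg_right ha he

/-- The Jacobian `Diag(a) - aᵀ a` of the softmax at the probability vector `a`, applied to `z`. -/
def softmaxJac [Fintype ι] (a z : ι → ℝ) (k : ι) : ℝ := a k * (z k - a ⬝ᵥ z)

theorem sum_abs_softmaxJac_le [Fintype ι] {a z : ι → ℝ} {e : ℝ} (ha : ∑ k, |a k| ≤ 1)
    (hz : ∀ k, |z k| ≤ e) (he : 0 ≤ e) : ∑ k, |softmaxJac a z k| ≤ 2 * e := by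
  have h := abs_dotProduct_le_of_sum_abs ha hz he
  calc ∑ k, |softmaxJac a z k| ≤ ∑ k, |a k| * (2 * e) := Finset.sum_le_sum fun k _ => by
        rw [softmaxJac, abs_mul]
        refine mul_le_mul_of_nonneg_left ((abs_sub _ _).trans ?_) (abs_nonneg _)
        linarith [hz k]
    _ ≤ 2 * e := by
        rw [← Finset.sum_mul]
        nlinarith

/-- The map is linear in the direction, which gives 2f. Moving the base point from `b` to `a`
changes the outer factor, at cost 2de, and the mean that is subtracted, at cost de. -/
theorem sum_abs_softmaxJac_sub_le [Fintype ι] {a b z w : ι → ℝ} {d e f : ℝ} (ha : ∑ k, |a k| ≤ 1)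
    (hb : ∑ k, |b k| ≤ 1) (hab : ∑ k, |a k - b k| ≤ d) (hw : ∀ k, |w k| ≤ e)
    (hzw : ∀ k, |z k - w k| ≤ f) (he : 0 ≤ e) (hf : 0 ≤ f) :
    ∑ k, |softmaxJac a z k - softmaxJac b w k| ≤ 2 * f + 3 * d * e := by
  have h1 := sum_abs_softmaxJac_le (z := z - w) ha hzw hf
  have h2 := abs_dotProduct_le_of_sum_abs (a := a - b) hab hw he
  have h3 := abs_dotProduct_le_of_sum_abs hb hw he
  have key : ∀ k, |softmaxJac a z k - softmaxJac b w k| ≤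
      |softmaxJac a (z - w) k| + (|a k - b k| * (2 * e) + |a k| * (d * e)) := by
    intro k
    have hsplit : softmaxJac a z k - softmaxJac b w k = softmaxJac a (z - w) k +
        ((a k - b k) * (w k - b ⬝ᵥ w) + -(a k * ((a - b) ⬝ᵥ w))) := by
      simp only [softmaxJac, Pi.sub_apply, dotProduct_sub, sub_dotProduct]
      ring
    rw [hsplit]
    refine (abs_add_le _ _).trans (add_le_add le_rfl ((abs_add_le _ _).trans (add_le_add ?_ ?_)))
    · rw [abs_mul]
      refine mul_le_mul_of_nonneg_left ((abs_sub _ _).trans ?_) (abs_nonneg _)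
      linarith [hw k]
    · rw [abs_neg, abs_mul]
      exact mul_le_mul_of_nonneg_left h2 (abs_nonneg _)
  have hd : 0 ≤ d := (Finset.sum_nonneg fun _ _ => abs_nonneg _).trans hab
  calc _ ≤ ∑ k, (|softmaxJac a (z - w) k| + (|a k - b k| * (2 * e) + |a k| * (d * e))) :=
        Finset.sum_le_sum fun k _ => key k
    _ ≤ _ := by
        simp only [Finset.sum_add_distrib, ← Finset.sum_mul]
        nlinarith [mul_nonneg hd he]

variable [DecidableEq ι]

theorem softmaxOn_nonneg (S : Finset ι) (z : ι → ℝ) (i : ι) : 0 ≤ softmaxOn S z i := by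
  unfold softmaxOn
  split_ifs <;> positivity

theorem softmaxOn_of_notMem {S : Finset ι} {i : ι} (hi : i ∉ S) (z : ι → ℝ) :
    softmaxOn S z i = 0 := if_neg hi

theorem softmaxOn_pos {S : Finset ι} {i : ι} (hi : i ∈ S) (z : ι → ℝ) : 0 < softmaxOn S z i := by
  rw [softmaxOn, if_pos hi]
  exact div_pos (Real.exp_pos _) (sum_exp_pos ⟨i, hi⟩ z)

theorem sum_softmaxOn [Fintype ι] {S : Finset ι} (hS : S.Nonempty) (z : ι → ℝ) :
    ∑ i, softmaxOn S z i = 1 := by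
  simp only [softmaxOn, Finset.sum_ite_mem, Finset.univ_inter, ← Finset.sum_div]
  exact div_self (sum_exp_pos hS z).ne'

/-- The numerator and the denominator each change by a factor of at most exp e. -/
theorem softmaxOn_le_exp_mul {S : Finset ι} {z w : ι → ℝ} {e : ℝ} (h : ∀ j ∈ S, |z j - w j| ≤ e)
    (i : ι) : softmaxOn S z i ≤ Real.exp (2 * e) * softmaxOn S w i := by
  by_cases hi : i ∈ S
  · have hS : S.Nonempty := ⟨i, hi⟩
    rw [softmaxOn, softmaxOn, if_pos hi, if_pos hi, ← mul_div_assoc,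
      div_le_div_iff₀ (sum_exp_pos hS z) (sum_exp_pos hS w)]
    have h1 : Real.exp (z i) ≤ Real.exp e * Real.exp (w i) := by
      rw [← Real.exp_add]
      exact Real.exp_le_exp.2 (by linarith [(abs_le.1 (h i hi)).2])
    have h2 : ∑ j ∈ S, Real.exp (w j) ≤ Real.exp e * ∑ j ∈ S, Real.exp (z j) := by
      rw [Finset.mul_sum]
      refine Finset.sum_le_sum fun j hj => ?_
      rw [← Real.exp_add]
      exact Real.exp_le_exp.2 (by linarith [(abs_le.1 (h j hj)).1])
    calc _ ≤ (Real.exp e * Real.exp (w i)) * (Real.exp e * ∑ j ∈ S, Real.exp (z j)) :=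
          mul_le_mul h1 h2 (sum_exp_pos hS w).le (by positivity)
      _ = _ := by
          rw [two_mul, Real.exp_add]
          ring
  · simp [softmaxOn_of_notMem hi]

/-- The multiplicative comparison makes every entry differ by at most (exp(2e) - 1) times the weight
at `w`, and these weights sum to 1. The bound is therefore independent of the number of positions.
-/
theorem sum_abs_softmaxOn_sub_le [Fintype ι] {S : Finset ι} (hS : S.Nonempty) {z w : ι → ℝ} {e : ℝ}
    (h : ∀ j ∈ S, |z j - w j| ≤ e) :
    ∑ i, |softmaxOn S z i - softmaxOn S w i| ≤ Real.exp (2 * e) - 1 := by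
  have he : 0 ≤ e := by
    obtain ⟨j, hj⟩ := hS
    exact (abs_nonneg _).trans (h j hj)
  have h1 : 1 ≤ Real.exp (2 * e) := Real.one_le_exp (by positivity)
  have key : ∀ i, |softmaxOn S z i - softmaxOn S w i| ≤
      (Real.exp (2 * e) - 1) * softmaxOn S w i := by
    intro i
    have hzw := softmaxOn_le_exp_mul h i
    have hwz := softmaxOn_le_exp_mul (z := w) (w := z)
      (fun j hj => by rw [abs_sub_comm]; exact h j hj) i
    have hw := softmaxOn_nonneg S w i
    rw [abs_le]
    constructor
    -- With E = exp(2e), the reverse comparison w ≤ E·z suffices because E(2 - E) = 1 - (E - 1)² ≤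
    -- 1.
    · by_contra! hlt
      have h2 : softmaxOn S z i < (2 - Real.exp (2 * e)) * softmaxOn S w i := by linarith
      have h3 : Real.exp (2 * e) * softmaxOn S z i <
          Real.exp (2 * e) * ((2 - Real.exp (2 * e)) * softmaxOn S w i) :=
        mul_lt_mul_of_pos_left h2 (Real.exp_pos _)
      nlinarith [mul_nonneg hw (sq_nonneg (Real.exp (2 * e) - 1))]
    · linarith
  calc _ ≤ ∑ i, (Real.exp (2 * e) - 1) * softmaxOn S w i := Finset.sum_le_sum fun i _ => key i
    _ = _ := by rw [← Finset.mul_sum, sum_softmaxOn hS, mul_one]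

theorem differentiable_softmaxOn {E : Type*} [NormedAddCommGroup E] [NormedSpace ℝ E]
    {S : Finset ι} (hS : S.Nonempty) {z : E → ι → ℝ} (h : ∀ j, Differentiable ℝ fun r => z r j)
    (i : ι) : Differentiable ℝ fun r => softmaxOn S (z r) i := by
  by_cases hi : i ∈ S
  · simp only [softmaxOn, if_pos hi, div_eq_mul_inv]
    exact (h i).exp.mul ((Differentiable.fun_sum fun j _ => (h j).exp).fun_inv
      fun r => (sum_exp_pos hS (z r)).ne')
  · simp only [softmaxOn_of_notMem hi]
    exact differentiable_const _

variable [Fintype ι]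

theorem hasDerivAt_softmaxOn {S : Finset ι} (hS : S.Nonempty) {z : ℝ → ι → ℝ} {z' : ι → ℝ} {x : ℝ}
    (h : ∀ j, HasDerivAt (fun r => z r j) (z' j) x) (i : ι) :
    HasDerivAt (fun r => softmaxOn S (z r) i) (softmaxJac (softmaxOn S (z x)) z' i) x := by
  have hpos := sum_exp_pos hS (z x)
  have hdot : softmaxOn S (z x) ⬝ᵥ z' =
      (∑ j ∈ S, Real.exp (z x j) * z' j) / ∑ j ∈ S, Real.exp (z x j) := by
    simp only [dotProduct, softmaxOn, ite_mul, zero_mul, Finset.sum_ite_mem, Finset.univ_inter,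
      Finset.sum_div, div_mul_eq_mul_div]
  by_cases hi : i ∈ S
  · have hden : HasDerivAt (fun r => ∑ j ∈ S, Real.exp (z r j))
        (∑ j ∈ S, Real.exp (z x j) * z' j) x := HasDerivAt.fun_sum fun j _ => (h j).exp
    rw [softmaxJac, hdot]
    simp only [softmaxOn, if_pos hi]
    refine ((h i).exp.fun_div hden hpos.ne').congr_deriv ?_
    field_simp
  · simp only [softmaxJac, softmaxOn_of_notMem hi, zero_mul]
    exact hasDerivAt_const _ _

theorem hasDerivAt_log_softmaxOn {S : Finset ι} {z : ℝ → ι → ℝ} {z' : ι → ℝ} {x : ℝ}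
    (h : ∀ j, HasDerivAt (fun r => z r j) (z' j) x) {i : ι} (hi : i ∈ S) :
    HasDerivAt (fun r => Real.log (softmaxOn S (z r) i)) (z' i - softmaxOn S (z x) ⬝ᵥ z') x := by
  have hpos := softmaxOn_pos hi (z x)
  refine ((hasDerivAt_softmaxOn ⟨i, hi⟩ h i).log hpos.ne').congr_deriv ?_
  rw [softmaxJac, mul_div_cancel_left₀ _ hpos.ne']

end Softmax

/-! ### The causal softmax -/

section Causal

variable {T : ℕ}

/-- The derivative of the causal softmax with attention pattern `A` in the direction `Z`. -/
def attentionJac (A Z : Matrix (Fin T) (Fin T) ℝ) : Matrix (Fin T) (Fin T) ℝ :=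
  Matrix.of fun t => softmaxJac (A t) (Z t)

theorem attentionJac_zero (A : Matrix (Fin T) (Fin T) ℝ) : attentionJac A 0 = 0 := by
  ext t k
  simp [attentionJac, softmaxJac, dotProduct]

theorem causalSoftmax_rowSumBound (Z : Matrix (Fin T) (Fin T) ℝ) :
    RowSumBound (causalSoftmax Z) 1 := by
  intro t
  simp only [causalSoftmax, Matrix.of_apply, abs_of_nonneg (softmaxOn_nonneg _ _ _)]
  exact (sum_softmaxOn Finset.nonempty_Iic _).le

theorem causalSoftmax_zero : causalSoftmax (0 : Matrix (Fin T) (Fin T) ℝ) = uniformAttention T := by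
  ext t k
  simp [causalSoftmax, softmaxOn, uniformAttention]

theorem uniformAttention_rowSumBound : RowSumBound (uniformAttention T) 1 := by
  rw [← causalSoftmax_zero]
  exact causalSoftmax_rowSumBound 0

theorem causalSoftmax_sub_uniformAttention {Z : Matrix (Fin T) (Fin T) ℝ} {e : ℝ}
    (hZ : EntryBound Z e) :
    RowSumBound (causalSoftmax Z - uniformAttention T) (Real.exp (2 * e) - 1) := by
  intro t
  rw [← causalSoftmax_zero]
  exact sum_abs_softmaxOn_sub_le Finset.nonempty_Iic fun j _ => by simpa using hZ t j

theorem attentionJac_rowSumBound {A Z : Matrix (Fin T) (Fin T) ℝ} {e : ℝ} (hA : RowSumBound A 1)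
    (hZ : EntryBound Z e) (he : 0 ≤ e) : RowSumBound (attentionJac A Z) (2 * e) :=
  fun t => sum_abs_softmaxJac_le (hA t) (hZ t) he

theorem attentionJac_sub_rowSumBound {A B Z W : Matrix (Fin T) (Fin T) ℝ} {d e f : ℝ}
    (hA : RowSumBound A 1) (hB : RowSumBound B 1) (hAB : RowSumBound (A - B) d)
    (hW : EntryBound W e) (hZW : EntryBound (Z - W) f) (he : 0 ≤ e) (hf : 0 ≤ f) :
    RowSumBound (attentionJac A Z - attentionJac B W) (2 * f + 3 * d * e) :=
  fun t => sum_abs_softmaxJac_sub_le (hA t) (hB t) (hAB t) (hW t) (hZW t) he hf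

end Causal

/-! ### Entrywise derivatives of matrix curves -/

section MatrixCurves

variable {ι κ σ : Type*}

/-- The curve `M` of matrices has the entrywise derivative `M'` at `x`. -/
def HasEntryDerivAt (M : ℝ → Matrix ι κ ℝ) (M' : Matrix ι κ ℝ) (x : ℝ) : Prop :=
  ∀ i j, HasDerivAt (fun r => M r i j) (M' i j) x

theorem HasEntryDerivAt.add {M N : ℝ → Matrix ι κ ℝ} {M' N' : Matrix ι κ ℝ} {x : ℝ}
    (hM : HasEntryDerivAt M M' x) (hN : HasEntryDerivAt N N' x) :
    HasEntryDerivAt (fun r => M r + N r) (M' + N') x := fun i j => (hM i j).add (hN i j)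

theorem HasEntryDerivAt.transpose {M : ℝ → Matrix ι κ ℝ} {M' : Matrix ι κ ℝ} {x : ℝ}
    (hM : HasEntryDerivAt M M' x) : HasEntryDerivAt (fun r => (M r)ᵀ) M'ᵀ x := fun i j => hM j i

theorem HasEntryDerivAt.mul [Fintype κ] {M : ℝ → Matrix ι κ ℝ} {N : ℝ → Matrix κ σ ℝ}
    {M' : Matrix ι κ ℝ} {N' : Matrix κ σ ℝ} {x : ℝ}
    (hM : HasEntryDerivAt M M' x) (hN : HasEntryDerivAt N N' x) :
    HasEntryDerivAt (fun r => M r * N r) (M' * N x + M x * N') x := by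
  intro i j
  simp only [Matrix.mul_apply, Matrix.add_apply, ← Finset.sum_add_distrib]
  exact HasDerivAt.fun_sum fun k _ => (hM i k).mul (hN k j)

theorem hasEntryDerivAt_line (M D : Matrix ι κ ℝ) (x : ℝ) :
    HasEntryDerivAt (fun r => M + r • D) D x := by
  intro i j
  simpa using ((hasDerivAt_id x).mul_const (D i j)).const_add (M i j)

theorem HasEntryDerivAt.causalSoftmax {T : ℕ} {Z : ℝ → Matrix (Fin T) (Fin T) ℝ}
    {Z' : Matrix (Fin T) (Fin T) ℝ} {x : ℝ} (hZ : HasEntryDerivAt Z Z' x) :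
    HasEntryDerivAt (fun r => causalSoftmax (Z r)) (attentionJac (causalSoftmax (Z x)) Z') x :=
  fun t k => hasDerivAt_softmaxOn Finset.nonempty_Iic (hZ t) k

end MatrixCurves

/-! ### Directional derivatives of the model -/

section Tangent

variable {𝒱 : Type*} {L T : ℕ}

theorem DM_zero : DM (0 : EuclideanSpace ℝ (Fin T)) = 0 := by
  ext t k
  simp [DM]

theorem DM_add_smul (p q : EuclideanSpace ℝ (Fin T)) (r : ℝ) :
    DM (p + r • q) = DM p + r • DM q := by
  ext t k
  simp only [DM, Matrix.of_apply, Matrix.add_apply, Matrix.smul_apply]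
  split_ifs <;> simp

variable [Fintype 𝒱]

/-- The derivative of the attention scores with parameters `W` on the hidden state `h`, in the
direction `dW`, `dp`, `d`. -/
def scoreTangent (W dW : Matrix 𝒱 𝒱 ℝ) (dp : EuclideanSpace ℝ (Fin T))
    (h d : Matrix (Fin T) 𝒱 ℝ) : Matrix (Fin T) (Fin T) ℝ :=
  d * W * hᵀ + h * dW * hᵀ + h * W * dᵀ + DM dp

/-- The derivative at `θ` of the hidden states in the direction `v`. -/
def hiddenTangent (θ v : Params 𝒱 L T) (X : Matrix (Fin T) 𝒱 ℝ) :
    Fin (L + 1) → Matrix (Fin T) 𝒱 ℝ :=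
  Fin.induction (motive := fun _ => Matrix (Fin T) 𝒱 ℝ) 0 fun l d =>
    d + ((attentionJac (attention (θ.keyQuery l) (θ.posEnc l) (hiddenState θ X l.castSucc))
          (scoreTangent (θ.keyQuery l) (v.keyQuery l) (v.posEnc l)
            (hiddenState θ X l.castSucc) d) * hiddenState θ X l.castSucc +
        attention (θ.keyQuery l) (θ.posEnc l) (hiddenState θ X l.castSucc) * d) * θ.value l +
      attention (θ.keyQuery l) (θ.posEnc l) (hiddenState θ X l.castSucc) *
        hiddenState θ X l.castSucc * v.value l)

theorem hiddenState_zero (θ : Params 𝒱 L T) (X : Matrix (Fin T) 𝒱 ℝ) : hiddenState θ X 0 = X := rfl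

theorem hiddenState_succ (θ : Params 𝒱 L T) (X : Matrix (Fin T) 𝒱 ℝ) (l : Fin L) :
    hiddenState θ X l.succ = hiddenState θ X l.castSucc +
      attention (θ.keyQuery l) (θ.posEnc l) (hiddenState θ X l.castSucc) *
        hiddenState θ X l.castSucc * θ.value l := rfl

theorem hiddenTangent_succ (θ v : Params 𝒱 L T) (X : Matrix (Fin T) 𝒱 ℝ) (l : Fin L) :
    hiddenTangent θ v X l.succ = hiddenTangent θ v X l.castSucc +
      ((attentionJac (attention (θ.keyQuery l) (θ.posEnc l) (hiddenState θ X l.castSucc))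
          (scoreTangent (θ.keyQuery l) (v.keyQuery l) (v.posEnc l)
            (hiddenState θ X l.castSucc) (hiddenTangent θ v X l.castSucc)) *
          hiddenState θ X l.castSucc +
        attention (θ.keyQuery l) (θ.posEnc l) (hiddenState θ X l.castSucc) *
          hiddenTangent θ v X l.castSucc) * θ.value l +
      attention (θ.keyQuery l) (θ.posEnc l) (hiddenState θ X l.castSucc) *
        hiddenState θ X l.castSucc * v.value l) := rfl

theorem hasEntryDerivAt_scores (W dW : Matrix 𝒱 𝒱 ℝ) (p dp : EuclideanSpace ℝ (Fin T))
    {h : ℝ → Matrix (Fin T) 𝒱 ℝ} {d : Matrix (Fin T) 𝒱 ℝ} (hh : HasEntryDerivAt h d 0) :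
    HasEntryDerivAt (fun r => h r * (W + r • dW) * (h r)ᵀ + DM (p + r • dp))
      (scoreTangent W dW dp (h 0) d) 0 := by
  have h1 := ((hh.mul (hasEntryDerivAt_line W dW 0)).mul hh.transpose).add
    (hasEntryDerivAt_line (DM p) (DM dp) 0)
  simp only [zero_smul, add_zero, Matrix.add_mul] at h1
  simp only [DM_add_smul]
  exact h1

theorem hasEntryDerivAt_hiddenState (θ v : Params 𝒱 L T) (X : Matrix (Fin T) 𝒱 ℝ)
    (l : Fin (L + 1)) :
    HasEntryDerivAt (fun r : ℝ => hiddenState (θ + r • v) X l) (hiddenTangent θ v X l) 0 := by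
  induction l using Fin.induction with
  | zero => exact fun t a => hasDerivAt_const _ _
  | succ l ih =>
    have hA : HasEntryDerivAt (fun r : ℝ => attention ((θ + r • v).keyQuery l)
        ((θ + r • v).posEnc l) (hiddenState (θ + r • v) X l.castSucc))
        (attentionJac (attention (θ.keyQuery l) (θ.posEnc l) (hiddenState θ X l.castSucc))
          (scoreTangent (θ.keyQuery l) (v.keyQuery l) (v.posEnc l)
            (hiddenState θ X l.castSucc) (hiddenTangent θ v X l.castSucc))) 0 := by
      have h1 := (hasEntryDerivAt_scores (θ.keyQuery l) (v.keyQuery l) (θ.posEnc l)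
        (v.posEnc l) ih).causalSoftmax
      simp only [zero_smul, add_zero] at h1
      exact h1
    have h2 := ih.add ((hA.mul ih).mul (hasEntryDerivAt_line (θ.value l) (v.value l) 0))
    simp only [zero_smul, add_zero] at h2
    exact h2

/-- The derivative of the logits at `θ` in the direction `v`. -/
def outputTangent (θ v : Params 𝒱 L T) (X : Matrix (Fin T) 𝒱 ℝ) : Matrix (Fin T) 𝒱 ℝ :=
  hiddenTangent θ v X (Fin.last L) * θ.output + hiddenState θ X (Fin.last L) * v.output

theorem hasEntryDerivAt_transformer (θ v : Params 𝒱 L T) (X : Matrix (Fin T) 𝒱 ℝ) :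
    HasEntryDerivAt (fun r : ℝ => transformer (θ + r • v) X) (outputTangent θ v X) 0 := by
  have h := (hasEntryDerivAt_hiddenState θ v X (Fin.last L)).mul
    (hasEntryDerivAt_line θ.output v.output 0)
  simp only [zero_smul, add_zero] at h
  exact h

/-! ### Differentiability of the hidden states -/

theorem differentiable_keyQuery (l : Fin L) (a b : 𝒱) :
    Differentiable ℝ fun θ : Params 𝒱 L T => θ.keyQuery l a b := by
  simp only [Params.keyQuery, Matrix.of_apply]
  fun_prop

theorem differentiable_value (l : Fin L) (a b : 𝒱) :
    Differentiable ℝ fun θ : Params 𝒱 L T => θ.value l a b := by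
  simp only [Params.value, Matrix.of_apply]
  fun_prop

theorem differentiable_output (a b : 𝒱) :
    Differentiable ℝ fun θ : Params 𝒱 L T => θ.output a b := by
  simp only [Params.output, Matrix.of_apply]
  fun_prop

theorem differentiable_DM_posEnc (l : Fin L) (t k : Fin T) :
    Differentiable ℝ fun θ : Params 𝒱 L T => DM (θ.posEnc l) t k := by
  simp only [DM, Params.posEnc, Matrix.of_apply]
  split_ifs <;> fun_prop

theorem differentiable_mul_apply {E ι κ σ : Type*} [NormedAddCommGroup E] [NormedSpace ℝ E]
    [Fintype κ] {M : E → Matrix ι κ ℝ} {N : E → Matrix κ σ ℝ}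
    (hM : ∀ i j, Differentiable ℝ fun e => M e i j) (hN : ∀ i j, Differentiable ℝ fun e => N e i j)
    (i : ι) (j : σ) : Differentiable ℝ fun e => (M e * N e) i j := by
  simp only [Matrix.mul_apply]
  exact Differentiable.fun_sum fun k _ => (hM i k).mul (hN k j)

theorem differentiable_hiddenState (X : Matrix (Fin T) 𝒱 ℝ) (l : Fin (L + 1)) :
    ∀ t a, Differentiable ℝ fun θ : Params 𝒱 L T => hiddenState θ X l t a := by
  induction l using Fin.induction with
  | zero => exact fun t a => differentiable_const _
  | succ l ih =>
    have hA : ∀ t k, Differentiable ℝ fun θ : Params 𝒱 L T => attention (θ.keyQuery l)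
        (θ.posEnc l) (hiddenState θ X l.castSucc) t k := fun t k =>
      differentiable_softmaxOn Finset.nonempty_Iic
        (fun j => (differentiable_mul_apply (differentiable_mul_apply ih
          (differentiable_keyQuery l)) (fun a j => ih j a) t j).add
            (differentiable_DM_posEnc l t j)) k
    exact fun t a => (ih t a).add (differentiable_mul_apply (differentiable_mul_apply hA ih)
      (differentiable_value l) t a)

/-! ### The gradient of the loss -/

variable [DecidableEq 𝒱] {N : ℕ}

/-- The predicted next-token probabilities. -/
def predictions (θ : Params 𝒱 L T) (X : Matrix (Fin T) 𝒱 ℝ) : Matrix (Fin T) 𝒱 ℝ :=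
  Matrix.of fun t => softmax (transformer θ X t)

/-- The residual `Y_i - 𝒮(F(X_i))`. -/
def residual (x : Fin N → Fin (T + 1) → 𝒱) (θ : Params 𝒱 L T) (i : Fin N) :
    Matrix (Fin T) 𝒱 ℝ := targetMatrix (x i) - predictions θ (inputMatrix (x i))

theorem sum_targetMatrix (x : Fin (T + 1) → 𝒱) (t : Fin T) : ∑ a, targetMatrix x t a = 1 := by
  simp [targetMatrix]

/-- The log-softmax contributes the logit tangent minus its softmax mean. Target rows sum to 1, so
the means collect into the predictions and the residual appears. -/
theorem hasDerivAt_loss [Nonempty 𝒱] (x : Fin N → Fin (T + 1) → 𝒱) (θ v : Params 𝒱 L T) :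
    HasDerivAt (fun r : ℝ => loss x (θ + r • v))
      (-meanPairing (residual x θ) fun i => outputTangent θ v (inputMatrix (x i))) 0 := by
  have h : ∀ i t, HasDerivAt (fun r : ℝ =>
      (fun a => Real.log (softmax (transformer (θ + r • v) (inputMatrix (x i)) t) a)) ⬝ᵥ
        targetMatrix (x i) t)
      (residual x θ i t ⬝ᵥ outputTangent θ v (inputMatrix (x i)) t) 0 := by
    intro i t
    have h1 : ∀ a, HasDerivAt (fun r : ℝ =>
        Real.log (softmax (transformer (θ + r • v) (inputMatrix (x i)) t) a) *
          targetMatrix (x i) t a) _ 0 := fun a =>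
      (hasDerivAt_log_softmaxOn (hasEntryDerivAt_transformer θ v (inputMatrix (x i)) t)
        (Finset.mem_univ a)).mul_const _
    refine (HasDerivAt.fun_sum fun a _ => h1 a).congr_deriv ?_
    simp only [sub_mul, Finset.sum_sub_distrib, ← Finset.mul_sum, sum_targetMatrix, mul_one,
      zero_smul, add_zero]
    have h3 : residual x θ i t ⬝ᵥ outputTangent θ v (inputMatrix (x i)) t =
        targetMatrix (x i) t ⬝ᵥ outputTangent θ v (inputMatrix (x i)) t -
        softmaxOn Finset.univ (transformer θ (inputMatrix (x i)) t) ⬝ᵥ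
          outputTangent θ v (inputMatrix (x i)) t := sub_dotProduct _ _ _
    rw [h3, dotProduct_comm (targetMatrix (x i) t)]
    rfl
  have h2 := (HasDerivAt.fun_sum fun i (_ : i ∈ Finset.univ) =>
    HasDerivAt.fun_sum fun t (_ : t ∈ Finset.univ) => h i t).const_mul (-1 / ((N : ℝ) * T))
  refine h2.congr_deriv ?_
  rw [meanPairing]
  ring

/-- Derivatives along lines do not determine `gradient`, which has the default value 0 where the
function is not Fréchet differentiable. -/
theorem differentiable_loss [Nonempty 𝒱] (x : Fin N → Fin (T + 1) → 𝒱) :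
    Differentiable ℝ (loss (L := L) x) := by
  unfold loss
  refine Differentiable.const_mul (Differentiable.fun_sum fun i _ =>
    Differentiable.fun_sum fun t _ => Differentiable.fun_sum fun a _ =>
    Differentiable.mul_const (Differentiable.log
      (differentiable_softmaxOn Finset.univ_nonempty (fun b => ?_) a)
      fun θ => (softmaxOn_pos (Finset.mem_univ a) _).ne') _) _
  exact differentiable_mul_apply (differentiable_hiddenState _ _) differentiable_output t b

theorem inner_gradient_loss [Nonempty 𝒱] (x : Fin N → Fin (T + 1) → 𝒱) (θ v : Params 𝒱 L T) :
    inner ℝ (gradient (loss x) θ) v =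
      -meanPairing (residual x θ) fun i => outputTangent θ v (inputMatrix (x i)) := by
  have h1 : HasFDerivAt (loss x) (fderiv ℝ (loss x) θ) (θ + (0 : ℝ) • v) := by
    simpa using (differentiable_loss x θ).hasFDerivAt
  have h2 : HasDerivAt (fun r : ℝ => θ + r • v) v 0 := by
    simpa using ((hasDerivAt_id (0 : ℝ)).smul_const v).const_add θ
  have h3 : HasDerivAt (fun r : ℝ => loss x (θ + r • v)) (fderiv ℝ (loss x) θ v) 0 :=
    HasFDerivAt.comp_hasDerivAt (l := loss x) (0 : ℝ) h1 h2
  rw [← h3.unique (hasDerivAt_loss x θ v), ← InnerProductSpace.toDual_apply_apply, toDual_gradient]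

end Tangent

/-! ### Size of the forward pass near the initialisation -/

theorem exp_le_one_add_two_mul {y : ℝ} (h0 : 0 ≤ y) (h1 : y ≤ 1) : Real.exp y ≤ 1 + 2 * y := by
  have h := (abs_le.1 (Real.abs_exp_sub_one_sub_id_le (abs_le.2 ⟨by linarith, h1⟩))).2
  nlinarith

theorem one_add_pow_le {y : ℝ} (n : ℕ) (h0 : 0 ≤ y) (h1 : n * y ≤ 1) :
    (1 + y) ^ n ≤ 1 + 2 * (n * y) := by
  refine le_trans ?_ (exp_le_one_add_two_mul (by positivity) h1)
  rw [Real.exp_nat_mul]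
  exact pow_le_pow_left₀ (by positivity) (by linarith [Real.add_one_le_exp y]) n

section Sizes

variable {𝒱 : Type*} [Fintype 𝒱] {L T : ℕ}

/-- The parameters have the order of magnitude that they reach at training time `D`. -/
structure SmallParams (θ : Params 𝒱 L T) (D : ℝ) : Prop where
  nonneg : 0 ≤ D
  le : D ≤ 1 / 12
  depth : L * D ≤ 1 / 12
  keyQuery : ∀ l, ‖θ.keyQuery l‖ ≤ 2 * D ^ 4
  posEnc : ∀ l, ‖θ.posEnc l‖ ≤ 2 * D ^ 4
  value : ∀ l, ‖θ.value l‖ ≤ D ^ 2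
  output : ‖θ.output‖ ≤ 7 / 6 * D

theorem attention_rowSumBound (W : Matrix 𝒱 𝒱 ℝ) (p : EuclideanSpace ℝ (Fin T))
    (h : Matrix (Fin T) 𝒱 ℝ) : RowSumBound (attention W p h) 1 := causalSoftmax_rowSumBound _

namespace SmallParams

variable {θ : Params 𝒱 L T} {D : ℝ} (hθ : SmallParams θ D)
include hθ

theorem pow_four_le : D ^ 4 ≤ D / 1728 := by
  have h := hθ.nonneg
  have h1 := pow_le_pow_left₀ h hθ.le 3
  nlinarith

/-- Here the depth is absorbed: l·D² ≤ (LD)·D ≤ D/12, so the growth over all layers is still only of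
order D. -/
theorem one_add_sq_pow_le (l : Fin (L + 1)) : (1 + D ^ 2) ^ (l : ℕ) ≤ 1 + D / 6 := by
  have h := hθ.nonneg
  have hl : ((l : ℕ) : ℝ) ≤ L := by exact_mod_cast Nat.lt_succ_iff.1 l.2
  have h1 : (l : ℕ) * D ^ 2 ≤ D / 12 := by nlinarith [hθ.depth, sq_nonneg D]
  exact (one_add_pow_le _ (sq_nonneg D) (by linarith [hθ.le])).trans (by linarith)

theorem one_add_two_mul_sq_pow_le (l : Fin (L + 1)) :
    (1 + 2 * D ^ 2) ^ (l : ℕ) ≤ 1 + D / 3 := by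
  have h := hθ.nonneg
  have hl : ((l : ℕ) : ℝ) ≤ L := by exact_mod_cast Nat.lt_succ_iff.1 l.2
  have h1 : (l : ℕ) * (2 * D ^ 2) ≤ D / 6 := by nlinarith [hθ.depth, sq_nonneg D]
  exact (one_add_pow_le _ (by positivity) (by linarith [hθ.le])).trans (by linarith)

variable {X : Matrix (Fin T) 𝒱 ℝ} (hX : RowBound X 1)
include hX

/-- Attention does not enlarge rows and the value matrix has norm at most D², so each layer
multiplies the bound on the state by 1 + D². -/
theorem hiddenState_sub_pow (l : Fin (L + 1)) :
    RowBound (hiddenState θ X l - X) ((1 + D ^ 2) ^ (l : ℕ) - 1) := by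
  induction l using Fin.induction with
  | zero => simpa [hiddenState_zero] using RowBound.zero
  | succ l ih =>
    have h1 : RowBound (hiddenState θ X l.castSucc) ((1 + D ^ 2) ^ (l : ℕ)) := by
      simpa using ih.add hX
    have h2 := (RowBound.mul_left (attention_rowSumBound (θ.keyQuery l) (θ.posEnc l)
      (EarlyFeatures.hiddenState θ X l.castSucc)) h1 (by positivity)).mul_right
        (hθ.value l) (by positivity)
    rw [hiddenState_succ, add_sub_right_comm]
    refine (ih.add h2).mono (le_of_eq ?_)
    simp only [Fin.val_castSucc, Fin.val_succ]
    ring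

theorem hiddenState_sub (l : Fin (L + 1)) : RowBound (hiddenState θ X l - X) (D / 6) :=
  (hθ.hiddenState_sub_pow hX l).mono (by linarith [hθ.one_add_sq_pow_le l])

theorem hiddenState (l : Fin (L + 1)) : RowBound (hiddenState θ X l) (73 / 72) := by
  have h := (hθ.hiddenState_sub hX l).add hX
  rw [sub_add_cancel] at h
  exact h.mono (by linarith [hθ.le])

omit hθ hX in
theorem entryBound_DM (p : EuclideanSpace ℝ (Fin T)) : EntryBound (DM p) ‖p‖ := by
  intro t k
  simp only [DM, Matrix.of_apply]
  split_ifs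
  · exact abs_le_l2 (fun m => p m) _
  · simp

theorem attention_sub (l : Fin L) :
    RowSumBound (attention (θ.keyQuery l) (θ.posEnc l) (EarlyFeatures.hiddenState θ X l.castSucc) -
      uniformAttention T) (D / 100) := by
  have hD := hθ.nonneg
  have h4 := hθ.pow_four_le
  have hh := hθ.hiddenState hX l.castSucc
  have h1 := (EntryBound.mul_transpose (hh.mul_right (hθ.keyQuery l) (by norm_num)) hh
    (by positivity)).add ((entryBound_DM (θ.posEnc l)).mono (hθ.posEnc l))
  -- The scores are at most ((73/72)² + 1)·2D⁴, and `pow_four_le` turns the resulting order D⁴ into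
  -- D/100.
  refine (causalSoftmax_sub_uniformAttention (h1.mono
    (show _ ≤ 41 / 10 * D ^ 4 by nlinarith [pow_nonneg hD 4]))).mono ?_
  have h5 := exp_le_one_add_two_mul (y := 2 * (41 / 10 * D ^ 4)) (by positivity)
    (by linarith [hθ.le])
  linarith

theorem attention_mul_sub (l : Fin L) :
    RowBound (attention (θ.keyQuery l) (θ.posEnc l) (EarlyFeatures.hiddenState θ X l.castSucc) *
      EarlyFeatures.hiddenState θ X l.castSucc - uniformAttention T * X) (9 / 50 * D) := by
  have h1 := RowBound.mul_left (attention_rowSumBound (θ.keyQuery l) (θ.posEnc l)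
    (EarlyFeatures.hiddenState θ X l.castSucc))
    (hθ.hiddenState_sub hX l.castSucc) (by linarith [hθ.nonneg])
  have h2 := RowBound.mul_left (hθ.attention_sub hX l) hX zero_le_one
  have h3 := h1.add h2
  rw [Matrix.mul_sub, Matrix.sub_mul] at h3
  refine RowBound.mono (c := 1 * (D / 6) + D / 100 * 1) ?_ (by linarith [hθ.nonneg])
  convert h3 using 1
  unfold attention
  abel

/-! ### Propagation of tangents -/

omit hθ hX in
-- The tangent starts at 0 and each step is linear in the incoming tangent and the direction of that
-- layer, so it stays 0 until a perturbed layer is reached.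
theorem hiddenTangent_eq_zero {v : Params 𝒱 L T} {l : Fin (L + 1)}
    (hK : ∀ m : Fin L, m.castSucc < l → v.keyQuery m = 0)
    (hP : ∀ m : Fin L, m.castSucc < l → v.posEnc m = 0)
    (hV : ∀ m : Fin L, m.castSucc < l → v.value m = 0) (i : Fin (L + 1)) (hi : i ≤ l) :
    hiddenTangent θ v X i = 0 := by
  induction i using Fin.induction with
  | zero => rfl
  | succ i ih =>
    have hlt : i.castSucc < l := Fin.castSucc_lt_succ.trans_le hi
    rw [hiddenTangent_succ, ih hlt.le, hK i hlt, hP i hlt, hV i hlt]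
    simp [scoreTangent, DM_zero, attentionJac_zero]

omit hθ hX in
theorem hiddenTangent_eq_zero_of_output {v : Params 𝒱 L T} (hK : ∀ m, v.keyQuery m = 0)
    (hP : ∀ m, v.posEnc m = 0) (hV : ∀ m, v.value m = 0) (X : Matrix (Fin T) 𝒱 ℝ)
    (i : Fin (L + 1)) : hiddenTangent θ v X i = 0 :=
  hiddenTangent_eq_zero (fun m _ => hK m) (fun m _ => hP m) (fun m _ => hV m) i le_rfl

omit hθ hX in
theorem hiddenTangent_layer {v : Params 𝒱 L T} {l : Fin L}
    (hK : ∀ m, m ≠ l → v.keyQuery m = 0) (hP : ∀ m, m ≠ l → v.posEnc m = 0)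
    (hV : ∀ m, m ≠ l → v.value m = 0) (X : Matrix (Fin T) 𝒱 ℝ) :
    hiddenTangent θ v X l.succ =
      attentionJac (attention (θ.keyQuery l) (θ.posEnc l)
          (EarlyFeatures.hiddenState θ X l.castSucc))
        (EarlyFeatures.hiddenState θ X l.castSucc * v.keyQuery l *
          (EarlyFeatures.hiddenState θ X l.castSucc)ᵀ + DM (v.posEnc l)) *
        EarlyFeatures.hiddenState θ X l.castSucc * θ.value l +
      attention (θ.keyQuery l) (θ.posEnc l) (EarlyFeatures.hiddenState θ X l.castSucc) *
        EarlyFeatures.hiddenState θ X l.castSucc * v.value l := by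
  have h0 : hiddenTangent θ v X l.castSucc = 0 :=
    hiddenTangent_eq_zero (l := l.castSucc)
      (fun m hm => hK m (Fin.castSucc_lt_castSucc_iff.1 hm).ne)
      (fun m hm => hP m (Fin.castSucc_lt_castSucc_iff.1 hm).ne)
      (fun m hm => hV m (Fin.castSucc_lt_castSucc_iff.1 hm).ne) _ le_rfl
  rw [hiddenTangent_succ, h0]
  simp [scoreTangent]

/-- In an unperturbed layer all new terms pass through the value matrix, which supplies D². The
response of the attention pattern is small because the key-query matrix is of order D⁴, so the
factor 2 covers it together with the transported tangent. -/
theorem hiddenTangent_step {v : Params 𝒱 L T} {m : Fin L} (hK : v.keyQuery m = 0)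
    (hP : v.posEnc m = 0) (hV : v.value m = 0) {c : ℝ} (hc : 0 ≤ c)
    (hd : RowBound (hiddenTangent θ v X m.castSucc) c) :
    RowBound (hiddenTangent θ v X m.succ - hiddenTangent θ v X m.castSucc) (2 * D ^ 2 * c) := by
  have hD := hθ.nonneg
  have h4 := hθ.pow_four_le
  have hh := hθ.hiddenState hX m.castSucc
  have hscore : EntryBound (scoreTangent (θ.keyQuery m) 0 0
      (EarlyFeatures.hiddenState θ X m.castSucc) (hiddenTangent θ v X m.castSucc))
      (1 / 10 * c) := by
    have h1 := EntryBound.mul_transpose (hd.mul_right (hθ.keyQuery m) hc) hh (by positivity)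
    have h2 := EntryBound.mul_transpose (hh.mul_right (hθ.keyQuery m) (by norm_num)) hd
      (by positivity)
    simp only [scoreTangent, DM_zero, Matrix.mul_zero, Matrix.zero_mul, add_zero]
    refine (h1.add h2).mono ?_
    nlinarith [hθ.le]
  have h1 := RowBound.mul_left (attentionJac_rowSumBound
    (attention_rowSumBound (θ.keyQuery m) (θ.posEnc m)
    (EarlyFeatures.hiddenState θ X m.castSucc)) hscore (by positivity)) hh
    (by norm_num)
  have h2 := RowBound.mul_left (attention_rowSumBound (θ.keyQuery m) (θ.posEnc m)
    (EarlyFeatures.hiddenState θ X m.castSucc)) hd hc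
  have h3 := (h1.add h2).mul_right (hθ.value m) (by positivity)
  rw [hiddenTangent_succ, add_sub_cancel_left, hK, hP, hV, Matrix.mul_zero, add_zero]
  refine h3.mono ?_
  nlinarith [mul_nonneg hc (sq_nonneg D)]

theorem hiddenTangent_sub {v : Params 𝒱 L T} {l : Fin L} (hK : ∀ m, l < m → v.keyQuery m = 0)
    (hP : ∀ m, l < m → v.posEnc m = 0) (hV : ∀ m, l < m → v.value m = 0) {c : ℝ} (hc : 0 ≤ c)
    (hd : RowBound (hiddenTangent θ v X l.succ) c) (i : Fin (L + 1)) (hi : l.succ ≤ i) :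
    RowBound (hiddenTangent θ v X i - hiddenTangent θ v X l.succ)
      (((1 + 2 * D ^ 2) ^ (i : ℕ) - 1) * c) := by
  have h1 : ∀ n : ℕ, 1 ≤ (1 + 2 * D ^ 2) ^ n := fun n => one_le_pow₀ (by nlinarith [sq_nonneg D])
  induction i using Fin.induction with
  | zero => exact absurd hi (by simp)
  | succ i ih =>
    rcases (Fin.succ_le_succ_iff.1 hi).eq_or_lt with rfl | hlt
    · rw [sub_self]
      exact RowBound.zero.mono (mul_nonneg (sub_nonneg.2 (h1 _)) hc)
    · have ih' := ih (Fin.succ_le_castSucc_iff.2 hlt)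
      have hd' := ih'.add hd
      rw [sub_add_cancel] at hd'
      have h2 := hθ.hiddenTangent_step hX (hK i hlt) (hP i hlt) (hV i hlt)
        (c := (1 + 2 * D ^ 2) ^ (i : ℕ) * c) (by positivity) (hd'.mono (by simp; linarith))
      have h3 := h2.add ih'
      rw [sub_add_sub_cancel] at h3
      refine h3.mono (le_of_eq ?_)
      simp only [Fin.val_castSucc, Fin.val_succ]
      ring

theorem hiddenTangent_last_sub {v : Params 𝒱 L T} {l : Fin L}
    (hK : ∀ m, l < m → v.keyQuery m = 0) (hP : ∀ m, l < m → v.posEnc m = 0)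
    (hV : ∀ m, l < m → v.value m = 0) {c : ℝ} (hc : 0 ≤ c)
    (hd : RowBound (hiddenTangent θ v X l.succ) c) :
    RowBound (hiddenTangent θ v X (Fin.last L) - hiddenTangent θ v X l.succ) (D / 3 * c) :=
  (hθ.hiddenTangent_sub hX hK hP hV hc hd _ (Fin.le_last _)).mono
    (mul_le_mul_of_nonneg_right (by linarith [hθ.one_add_two_mul_sq_pow_le (Fin.last L)]) hc)

end SmallParams

end Sizes

/-! ### The gradient near the initialisation -/

section Residuals

variable {𝒱 : Type*} [Fintype 𝒱] [DecidableEq 𝒱] {N L T : ℕ}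

theorem inputMatrix_rowBound (x : Fin (T + 1) → 𝒱) : RowBound (inputMatrix x) 1 := by
  intro t
  have h : l2 (inputMatrix x t) ^ 2 = 1 := by
    rw [l2_sq]
    simp [inputMatrix]
  nlinarith [l2_nonneg (inputMatrix x t)]

/-- The residual `Y_i - U_O` at the initialisation. -/
def initialResidual (x : Fin N → Fin (T + 1) → 𝒱) (i : Fin N) : Matrix (Fin T) 𝒱 ℝ :=
  targetMatrix (x i) - uniformOutput 𝒱 T

theorem initialResidual_rowBound [Nonempty 𝒱] (x : Fin N → Fin (T + 1) → 𝒱) (i : Fin N) :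
    RowBound (initialResidual x i) 1 := by
  intro t
  have hn : (0 : ℝ) < Fintype.card 𝒱 := by exact_mod_cast Fintype.card_pos
  have h : l2 (initialResidual x i t) ^ 2 = 1 - 1 / (Fintype.card 𝒱 : ℝ) := by
    have h1 : ∀ a, initialResidual x i t a ^ 2 =
        (1 - 2 / (Fintype.card 𝒱 : ℝ)) * targetMatrix (x i) t a + 1 / (Fintype.card 𝒱 : ℝ) ^ 2 := by
      intro a
      simp only [initialResidual, targetMatrix, uniformOutput, Matrix.sub_apply, Matrix.of_apply]
      split_ifs <;> ring
    rw [l2_sq, Finset.sum_congr rfl fun a _ => h1 a, Finset.sum_add_distrib, ← Finset.mul_sum,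
      sum_targetMatrix]
    simp only [Finset.sum_const, Finset.card_univ, nsmul_eq_mul]
    field_simp
    ring
  have h2 : 0 < 1 / (Fintype.card 𝒱 : ℝ) := by positivity
  nlinarith [l2_nonneg (initialResidual x i t)]

namespace SmallParams

variable {θ : Params 𝒱 L T} {D : ℝ} (hθ : SmallParams θ D)
include hθ

theorem residual_sub [Nonempty 𝒱] (x : Fin N → Fin (T + 1) → 𝒱) (i : Fin N) :
    RowBound (residual x θ i - initialResidual x i) (3 * D) := by
  intro t
  have hD := hθ.nonneg
  have hF := (hθ.hiddenState (inputMatrix_rowBound (x i)) (Fin.last L)).mul_right hθ.output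
    (by norm_num)
  have hunif : uniformOutput 𝒱 T t = softmax (0 : 𝒱 → ℝ) := by
    ext a
    simp [uniformOutput, softmax, softmaxOn]
  have hrow : (residual x θ i - initialResidual x i) t =
      -(softmax (transformer θ (inputMatrix (x i)) t) - softmax 0) := by
    rw [← hunif]
    ext a
    simp only [residual, initialResidual, predictions, Matrix.sub_apply, Matrix.of_apply,
      Pi.neg_apply, Pi.sub_apply]
    ring
  have hsum := sum_abs_softmaxOn_sub_le (Finset.univ_nonempty (α := 𝒱))
    (z := transformer θ (inputMatrix (x i)) t) (w := 0) (e := 119 / 100 * D) fun j _ => by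
      rw [Pi.zero_apply, sub_zero]
      refine ((abs_le_l2 _ j).trans (hF t)).trans ?_
      linarith
  rw [hrow, l2_neg]
  refine ((l2_le_sum_abs _).trans hsum).trans ?_
  -- The second-order bound is needed: exp y ≤ 1 + 2y would give more than 3D, whereas y + y² with y
  -- = 2.38·D and D ≤ 1/12 stays below it.
  have h := (abs_le.1 (Real.abs_exp_sub_one_sub_id_le (x := 2 * (119 / 100 * D))
    (abs_le.2 ⟨by linarith, by linarith [hθ.le]⟩))).2
  nlinarith [hθ.le]

/-- The derivative of the loss with respect to the output matrix. -/
theorem inner_gradient_output [Nonempty 𝒱] (x : Fin N → Fin (T + 1) → 𝒱) {v : Params 𝒱 L T}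
    (hK : ∀ m, v.keyQuery m = 0) (hP : ∀ m, v.posEnc m = 0) (hV : ∀ m, v.value m = 0) :
    |-inner ℝ (gradient (loss x) θ) v -
      meanPairing (initialResidual x) fun i => inputMatrix (x i) * v.output| ≤
      4 * D * ‖v.output‖ := by
  have hD := hθ.nonneg
  have hn := norm_nonneg v.output
  rw [inner_gradient_loss, neg_neg]
  have hM : ∀ i, RowBound (outputTangent θ v (inputMatrix (x i))) (73 / 72 * ‖v.output‖) := by
    intro i
    rw [outputTangent, hiddenTangent_eq_zero_of_output hK hP hV, Matrix.zero_mul, zero_add]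
    exact (hθ.hiddenState (inputMatrix_rowBound _) _).mul_right le_rfl (by norm_num)
  have hM' : ∀ i, RowBound (outputTangent θ v (inputMatrix (x i)) - inputMatrix (x i) * v.output)
      (D / 6 * ‖v.output‖) := by
    intro i
    rw [outputTangent, hiddenTangent_eq_zero_of_output hK hP hV, Matrix.zero_mul, zero_add,
      ← Matrix.sub_mul]
    exact (hθ.hiddenState_sub (inputMatrix_rowBound _) _).mul_right le_rfl (by positivity)
  refine (abs_meanPairing_sub_le (by positivity) (by positivity) zero_le_one (by positivity)
    (hθ.residual_sub x) hM (initialResidual_rowBound x) hM').trans ?_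
  nlinarith [mul_nonneg hD hn]

/-- The derivative of the loss with respect to the parameters of one layer, in terms of an
approximation `E` of the derivative of the state that this layer produces. -/
theorem inner_gradient_layer [Nonempty 𝒱] (x : Fin N → Fin (T + 1) → 𝒱) {v : Params 𝒱 L T}
    {l : Fin L} (hK : ∀ m, m ≠ l → v.keyQuery m = 0) (hP : ∀ m, m ≠ l → v.posEnc m = 0)
    (hV : ∀ m, m ≠ l → v.value m = 0) (hO : v.output = 0) {B : Matrix 𝒱 𝒱 ℝ}
    (hB : ‖θ.output - D • B‖ ≤ 2 * D ^ 2) {E : Fin N → Matrix (Fin T) 𝒱 ℝ} {c e f : ℝ}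
    (hc : 0 ≤ c) (he : 0 ≤ e) (hf : 0 ≤ f)
    (hd : ∀ i, RowBound (hiddenTangent θ v (inputMatrix (x i)) l.succ) c)
    (hE : ∀ i, RowBound (E i) e)
    (hdE : ∀ i, RowBound (hiddenTangent θ v (inputMatrix (x i)) l.succ - E i) f) :
    |-inner ℝ (gradient (loss x) θ) v - D * meanPairing (initialResidual x) fun i => E i * B| ≤
      4 * D ^ 2 * c + 7 / 6 * D * f + 2 * D ^ 2 * e := by
  have hD := hθ.nonneg
  rw [inner_gradient_loss, neg_neg, ← meanPairing_smul_right]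
  have hlast : ∀ i, RowBound (hiddenTangent θ v (inputMatrix (x i)) (Fin.last L) -
      hiddenTangent θ v (inputMatrix (x i)) l.succ) (D / 3 * c) := fun i =>
    hθ.hiddenTangent_last_sub (inputMatrix_rowBound (x i)) (fun m hm => hK m hm.ne')
      (fun m hm => hP m hm.ne') (fun m hm => hV m hm.ne') hc (hd i)
  have hout : ∀ i, outputTangent θ v (inputMatrix (x i)) =
      hiddenTangent θ v (inputMatrix (x i)) (Fin.last L) * θ.output := by
    intro i
    rw [outputTangent, hO, Matrix.mul_zero, add_zero]
  have hM : ∀ i, RowBound (outputTangent θ v (inputMatrix (x i)))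
      ((D / 3 * c + c) * (7 / 6 * D)) := by
    intro i
    have h := (hlast i).add (hd i)
    rw [sub_add_cancel] at h
    rw [hout]
    exact h.mul_right hθ.output (by positivity)
  have hM' : ∀ i, RowBound (outputTangent θ v (inputMatrix (x i)) - D • (E i * B))
      ((D / 3 * c + f) * (7 / 6 * D) + e * (2 * D ^ 2)) := by
    intro i
    have h1 := ((hlast i).add (hdE i)).mul_right hθ.output (by positivity)
    have h2 := h1.add ((hE i).mul_right hB he)
    convert h2 using 1
    rw [hout, Matrix.mul_sub, sub_add_sub_cancel, Matrix.sub_mul, Matrix.mul_smul]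
    abel
  -- The coefficient of D²c is 7/2·(1 + D/3) from the residual and 7/18 from propagation to the last
  -- layer; for D ≤ 1/12 this is just below 4.
  refine (abs_meanPairing_sub_le (by positivity) (by positivity) zero_le_one (by positivity)
    (hθ.residual_sub x) hM (initialResidual_rowBound x) hM').trans ?_
  have h1 := mul_nonneg (sq_nonneg D) hc
  have h2 := mul_le_mul_of_nonneg_left hθ.le h1
  nlinarith

/-- The derivative of the loss with respect to a value matrix. -/
theorem inner_gradient_value [Nonempty 𝒱] (x : Fin N → Fin (T + 1) → 𝒱) {v : Params 𝒱 L T}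
    {l : Fin L} (hK : ∀ m, v.keyQuery m = 0) (hP : ∀ m, v.posEnc m = 0)
    (hV : ∀ m, m ≠ l → v.value m = 0) (hO : v.output = 0) {B : Matrix 𝒱 𝒱 ℝ}
    (hB : ‖θ.output - D • B‖ ≤ 2 * D ^ 2) :
    |-inner ℝ (gradient (loss x) θ) v - D * meanPairing (initialResidual x) fun i =>
      uniformAttention T * inputMatrix (x i) * v.value l * B| ≤ 12 * D ^ 2 * ‖v.value l‖ := by
  have hD := hθ.nonneg
  have hn := norm_nonneg (v.value l)
  have htan : ∀ X, hiddenTangent θ v X l.succ =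
      attention (θ.keyQuery l) (θ.posEnc l) (EarlyFeatures.hiddenState θ X l.castSucc) *
        EarlyFeatures.hiddenState θ X l.castSucc * v.value l := by
    intro X
    rw [hiddenTangent_layer (fun m _ => hK m) (fun m _ => hP m) hV, hK, hP, DM_zero]
    simp [attentionJac_zero]
  refine (hθ.inner_gradient_layer x (fun m _ => hK m) (fun m _ => hP m) hV hO hB
    (c := 1 * (73 / 72) * ‖v.value l‖) (e := 1 * 1 * ‖v.value l‖)
    (f := 9 / 50 * D * ‖v.value l‖) (by positivity) (by positivity) (by positivity)
    (fun i => ?_) (fun i => ?_) fun i => ?_).trans ?_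
  · rw [htan]
    exact (RowBound.mul_left (attention_rowSumBound _ _ _)
      (hθ.hiddenState (inputMatrix_rowBound (x i)) _) (by norm_num)).mul_right le_rfl (by norm_num)
  · exact (RowBound.mul_left uniformAttention_rowSumBound (inputMatrix_rowBound (x i))
      zero_le_one).mul_right le_rfl (by norm_num)
  · rw [htan, ← Matrix.sub_mul]
    exact (hθ.attention_mul_sub (inputMatrix_rowBound (x i)) l).mul_right le_rfl (by positivity)
  · nlinarith [mul_nonneg (sq_nonneg D) hn]

/-- The derivative of the loss with respect to the attention parameters of one layer. -/
theorem inner_gradient_attention [Nonempty 𝒱] (x : Fin N → Fin (T + 1) → 𝒱) {v : Params 𝒱 L T}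
    {l : Fin L} (hK : ∀ m, m ≠ l → v.keyQuery m = 0) (hP : ∀ m, m ≠ l → v.posEnc m = 0)
    (hV : ∀ m, v.value m = 0) (hO : v.output = 0) {B C : Matrix 𝒱 𝒱 ℝ} {κ : ℝ}
    (hB : ‖θ.output - D • B‖ ≤ 2 * D ^ 2) (hC : ‖θ.value l - κ • C‖ ≤ 4 * D ^ 3)
    (hκ : ‖κ • C‖ ≤ D ^ 2 / 2) :
    |-inner ℝ (gradient (loss x) θ) v - D * κ * meanPairing (initialResidual x) fun i =>
      attentionJac (uniformAttention T)
        (inputMatrix (x i) * v.keyQuery l * (inputMatrix (x i))ᵀ + DM (v.posEnc l)) *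
        inputMatrix (x i) * C * B| ≤ 65 * D ^ 4 * (‖v.keyQuery l‖ + ‖v.posEnc l‖) := by
  have hD := hθ.nonneg
  set n := ‖v.keyQuery l‖ with hn_def
  set p := ‖v.posEnc l‖ with hp_def
  have hn : 0 ≤ n := norm_nonneg _
  have hp : 0 ≤ p := norm_nonneg _
  have htan : ∀ X, hiddenTangent θ v X l.succ = attentionJac
      (attention (θ.keyQuery l) (θ.posEnc l) (EarlyFeatures.hiddenState θ X l.castSucc))
        (EarlyFeatures.hiddenState θ X l.castSucc * v.keyQuery l *
          (EarlyFeatures.hiddenState θ X l.castSucc)ᵀ + DM (v.posEnc l)) *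
        EarlyFeatures.hiddenState θ X l.castSucc * θ.value l := by
    intro X
    rw [hiddenTangent_layer hK hP (fun m _ => hV m), hV]
    simp
  have hz0 : ∀ i, EntryBound (inputMatrix (x i) * v.keyQuery l * (inputMatrix (x i))ᵀ +
      DM (v.posEnc l)) (n + p) := fun i =>
    ((EntryBound.mul_transpose ((inputMatrix_rowBound (x i)).mul_right le_rfl zero_le_one)
      (inputMatrix_rowBound (x i)) (by positivity)).add (entryBound_DM _)).mono (by linarith)
  have hz : ∀ i, EntryBound (EarlyFeatures.hiddenState θ (inputMatrix (x i)) l.castSucc *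
      v.keyQuery l * (EarlyFeatures.hiddenState θ (inputMatrix (x i)) l.castSucc)ᵀ +
      DM (v.posEnc l)) (21 / 20 * (n + p)) := fun i =>
    ((EntryBound.mul_transpose ((hθ.hiddenState (inputMatrix_rowBound (x i)) _).mul_right le_rfl
      (by norm_num)) (hθ.hiddenState (inputMatrix_rowBound (x i)) _) (by positivity)).add
        (entryBound_DM _)).mono (by linarith)
  have hzz : ∀ i, EntryBound (EarlyFeatures.hiddenState θ (inputMatrix (x i)) l.castSucc *
      v.keyQuery l * (EarlyFeatures.hiddenState θ (inputMatrix (x i)) l.castSucc)ᵀ +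
      DM (v.posEnc l) - (inputMatrix (x i) * v.keyQuery l * (inputMatrix (x i))ᵀ +
      DM (v.posEnc l))) (17 / 50 * D * (n + p)) := by
    intro i
    have hX := inputMatrix_rowBound (x i)
    have h1 := EntryBound.mul_transpose ((hθ.hiddenState_sub hX l.castSucc).mul_right
      (le_refl ‖v.keyQuery l‖) (by positivity)) (hθ.hiddenState hX l.castSucc) (by positivity)
    have h2 := EntryBound.mul_transpose (hX.mul_right (le_refl ‖v.keyQuery l‖) zero_le_one)
      (hθ.hiddenState_sub hX l.castSucc) (by positivity)
    have h3 := (h1.add h2).mono (show _ ≤ 17 / 50 * D * (n + p) by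
      nlinarith [mul_nonneg hD hn, mul_nonneg hD hp])
    convert h3 using 1
    rw [Matrix.transpose_sub, Matrix.mul_sub, Matrix.sub_mul, Matrix.sub_mul]
    abel
  have hJ0 : ∀ i, RowSumBound (attentionJac (uniformAttention T)
      (inputMatrix (x i) * v.keyQuery l * (inputMatrix (x i))ᵀ + DM (v.posEnc l)))
      (2 * (n + p)) := fun i =>
    attentionJac_rowSumBound uniformAttention_rowSumBound (hz0 i) (by positivity)
  have hJ := fun i => attentionJac_rowSumBound (attention_rowSumBound (θ.keyQuery l) (θ.posEnc l)
    (EarlyFeatures.hiddenState θ (inputMatrix (x i)) l.castSucc)) (hz i) (by positivity)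
  have hJJ := fun i => (attentionJac_sub_rowSumBound (attention_rowSumBound (θ.keyQuery l)
    (θ.posEnc l) (EarlyFeatures.hiddenState θ (inputMatrix (x i)) l.castSucc))
    uniformAttention_rowSumBound (hθ.attention_sub (inputMatrix_rowBound (x i)) l) (hz0 i) (hzz i)
    (by positivity) (by positivity)).mono (show _ ≤ 18 / 25 * D * (n + p) by
      nlinarith [mul_nonneg hD hn, mul_nonneg hD hp])
  have hmain := hθ.inner_gradient_layer x hK hP (fun m _ => hV m) hO hB
    (E := fun i => attentionJac (uniformAttention T)
        (inputMatrix (x i) * v.keyQuery l * (inputMatrix (x i))ᵀ + DM (v.posEnc l)) *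
        inputMatrix (x i) * (κ • C))
    (c := 2 * (21 / 20 * (n + p)) * (73 / 72) * D ^ 2)
    (e := 2 * (n + p) * 1 * (D ^ 2 / 2))
    (f := 10 * D ^ 3 * (n + p)) (by positivity) (by positivity) (by positivity)
    (fun i => ?_) (fun i => ?_) fun i => ?_
  · simp only [Matrix.mul_smul, Matrix.smul_mul, meanPairing_smul_right, ← mul_assoc] at hmain
    refine hmain.trans ?_
    nlinarith [mul_nonneg (pow_nonneg hD 4) hn, mul_nonneg (pow_nonneg hD 4) hp]
  · rw [htan]
    exact (RowBound.mul_left (hJ i) (hθ.hiddenState (inputMatrix_rowBound (x i)) _)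
      (by norm_num)).mul_right (hθ.value l) (by positivity)
  · exact (RowBound.mul_left (hJ0 i) (inputMatrix_rowBound (x i)) zero_le_one).mul_right hκ
      (by positivity)
  -- The product Jacobian · state · value is telescoped: each factor in turn is replaced by its
  -- leading term. The value error 4D³ dominates, contributing 8D³ of the 10D³.
  · have h1 := (RowBound.mul_left (hJJ i) (hθ.hiddenState (inputMatrix_rowBound (x i)) l.castSucc)
      (by norm_num)).mul_right (hθ.value l) (by positivity)
    have h2 := (RowBound.mul_left (hJ0 i) (hθ.hiddenState_sub (inputMatrix_rowBound (x i))
      l.castSucc) (by positivity)).mul_right (hθ.value l) (by positivity)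
    have h3 := (RowBound.mul_left (hJ0 i) (inputMatrix_rowBound (x i)) zero_le_one).mul_right hC
      (by positivity)
    have h4 := ((h1.add h2).add h3).mono (show _ ≤ 10 * D ^ 3 * (n + p) by
      nlinarith [mul_nonneg (pow_nonneg hD 3) hn, mul_nonneg (pow_nonneg hD 3) hp])
    rw [htan]
    convert h4 using 1
    simp only [Matrix.sub_mul, Matrix.mul_sub]
    abel

end SmallParams

end Residuals

/-! ### The statistics as averages of rank-one matrices -/

section Adjoints

variable {ι κ σ : Type*} [Fintype ι] [Fintype κ] [Fintype σ]

theorem frobInner_eq_trace (M N : Matrix ι κ ℝ) : frobInner M N = (Mᵀ * N).trace := by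
  simp only [frobInner, Matrix.trace, Matrix.diag, Matrix.mul_apply, Matrix.transpose_apply]
  exact Finset.sum_comm

theorem frobInner_mul_left (G : Matrix ι κ ℝ) (P : Matrix ι σ ℝ) (δ : Matrix σ κ ℝ) :
    frobInner G (P * δ) = frobInner (Pᵀ * G) δ := by
  rw [frobInner_eq_trace, frobInner_eq_trace, Matrix.transpose_mul, Matrix.transpose_transpose,
    Matrix.mul_assoc]

theorem frobInner_mul_right (G : Matrix ι κ ℝ) (δ : Matrix ι σ ℝ) (B : Matrix σ κ ℝ) :
    frobInner G (δ * B) = frobInner (G * Bᵀ) δ := by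
  rw [frobInner_eq_trace, frobInner_eq_trace, Matrix.transpose_mul, Matrix.transpose_transpose,
    ← Matrix.mul_assoc, Matrix.trace_mul_comm, Matrix.mul_assoc]

theorem frobInner_sum_left {N : ℕ} (M : Fin N → Matrix ι κ ℝ) (δ : Matrix ι κ ℝ) :
    frobInner (∑ i, M i) δ = ∑ i, frobInner (M i) δ := by
  simp only [frobInner_eq_trace, Matrix.transpose_sum, Matrix.sum_mul, Matrix.trace_sum]

theorem meanPairing_eq_sum_frobInner {N T : ℕ} (G M : Fin N → Matrix (Fin T) κ ℝ) :
    meanPairing G M = 1 / ((N : ℝ) * T) * ∑ i, frobInner (G i) (M i) := rfl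

end Adjoints

section Identities

variable {𝒱 : Type*} [DecidableEq 𝒱] {N T : ℕ}

/-- The occurrence counts cancel. If `a` never occurs as an input, both sides vanish because the
joint count is 0 as well. -/
theorem tokenFreq_mul_nextFreq (x : Fin N → Fin (T + 1) → 𝒱) (a b : 𝒱) :
    tokenFreq x a * nextFreq x a b =
      ((Finset.univ.filter fun q : Fin N × Fin T =>
        x q.1 q.2.castSucc = a ∧ x q.1 q.2.succ = b).card : ℝ) / ((N : ℝ) * T) := by
  rw [tokenFreq, nextFreq]
  set s := Finset.univ.filter fun q : Fin N × Fin T => x q.1 q.2.castSucc = a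
  set s' := Finset.univ.filter fun q : Fin N × Fin T =>
    x q.1 q.2.castSucc = a ∧ x q.1 q.2.succ = b
  have hsub : s'.card ≤ s.card := Finset.card_le_card fun q hq => by
    simp only [s, s', Finset.mem_filter] at hq ⊢
    exact ⟨hq.1, hq.2.1⟩
  rcases Nat.eq_zero_or_pos s.card with h | h
  · have h' : s'.card = 0 := by omega
    simp [h, h']
  · have h' : (s.card : ℝ) ≠ 0 := by positivity
    field_simp

theorem uniformAttention_mul_inputMatrix_apply (x : Fin (T + 1) → 𝒱) (k : Fin T) (b : 𝒱) :
    (uniformAttention T * inputMatrix x) k b =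
      1 / ((k : ℝ) + 1) * ∑ m ∈ Finset.Iic k, if x m.castSucc = b then (1 : ℝ) else 0 := by
  simp only [Matrix.mul_apply, uniformAttention, inputMatrix, Matrix.of_apply, Finset.mul_sum,
    ite_mul, zero_mul]
  rw [← Finset.sum_filter]
  refine Finset.sum_congr ?_ fun _ _ => rfl
  ext m
  simp

theorem context_eq (x : Fin N → Fin (T + 1) → 𝒱) :
    context x = (1 / ((N : ℝ) * T)) •
      ∑ i, (targetMatrix (x i))ᵀ * (uniformAttention T * inputMatrix (x i)) := by
  ext a b
  have hj : ∀ k m : Fin T, jointProb x k.succ m.castSucc a b = 1 / (N : ℝ) * ∑ i,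
      (if x i k.succ = a then (1 : ℝ) else 0) * if x i m.castSucc = b then (1 : ℝ) else 0 := by
    intro k m
    simp only [jointProb, Finset.card_filter, ite_and]
    push_cast
    rw [div_eq_inv_mul, one_div]
    congr 1
    refine Finset.sum_congr rfl fun i _ => ?_
    split_ifs <;> simp
  have h1 : ∀ i, ((targetMatrix (x i))ᵀ * (uniformAttention T * inputMatrix (x i))) a b =
      ∑ k : Fin T, (if x i k.succ = a then (1 : ℝ) else 0) * (1 / ((k : ℝ) + 1) *
        ∑ m ∈ Finset.Iic k, if x i m.castSucc = b then (1 : ℝ) else 0) := by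
    intro i
    rw [Matrix.mul_apply]
    refine Finset.sum_congr rfl fun k _ => ?_
    rw [uniformAttention_mul_inputMatrix_apply]
    rfl
  rw [Matrix.smul_apply, Matrix.sum_apply, Finset.sum_congr rfl fun i _ => h1 i]
  simp only [context, Matrix.of_apply, hj, smul_eq_mul]
  rw [Finset.sum_comm]
  simp only [Finset.mul_sum]
  refine Finset.sum_congr rfl fun k _ => ?_
  rw [Finset.sum_comm]
  refine Finset.sum_congr rfl fun i _ => Finset.sum_congr rfl fun m _ => ?_
  field_simp

variable [Fintype 𝒱]

theorem bigramBar_eq (x : Fin N → Fin (T + 1) → 𝒱) :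
    bigramBar x = (1 / ((N : ℝ) * T)) • ∑ i, (inputMatrix (x i))ᵀ * initialResidual x i := by
  ext a b
  have h1 : ∀ i, ((inputMatrix (x i))ᵀ * initialResidual x i) a b =
      ∑ t : Fin T, ((if x i t.castSucc = a ∧ x i t.succ = b then (1 : ℝ) else 0) -
        (if x i t.castSucc = a then (1 : ℝ) else 0) / (Fintype.card 𝒱 : ℝ)) := by
    intro i
    rw [Matrix.mul_apply]
    refine Finset.sum_congr rfl fun t _ => ?_
    simp only [Matrix.transpose_apply, inputMatrix, initialResidual, targetMatrix, uniformOutput,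
      Matrix.sub_apply, Matrix.of_apply, ite_and]
    split_ifs <;> ring
  have h2 : bigramBar x a b =
      tokenFreq x a * nextFreq x a b - tokenFreq x a / (Fintype.card 𝒱 : ℝ) := rfl
  rw [h2, tokenFreq_mul_nextFreq, tokenFreq, Matrix.smul_apply, Matrix.sum_apply,
    Finset.sum_congr rfl fun i _ => h1 i, Finset.card_filter, Finset.card_filter,
    Fintype.sum_prod_type, Fintype.sum_prod_type]
  push_cast
  simp only [Finset.sum_sub_distrib, ← Finset.sum_div, smul_eq_mul]
  ring

/-- Centring the columns is the same as replacing Y by Y - U_O: each row of Y sums to 1, so the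
column sums of the context matrix are the sums of the entries of A₀X. -/
theorem contextBar_eq (x : Fin N → Fin (T + 1) → 𝒱) :
    contextBar x = (1 / ((N : ℝ) * T)) •
      ∑ i, (initialResidual x i)ᵀ * (uniformAttention T * inputMatrix (x i)) := by
  have hcol : ∀ b, ∑ c, context x c b = 1 / ((N : ℝ) * T) *
      ∑ i, ∑ k, (uniformAttention T * inputMatrix (x i)) k b := by
    intro b
    simp only [context_eq, Matrix.smul_apply, Matrix.sum_apply, smul_eq_mul, ← Finset.mul_sum]
    congr 1
    rw [Finset.sum_comm]
    refine Finset.sum_congr rfl fun i _ => ?_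
    simp only [Matrix.mul_apply (M := (targetMatrix _)ᵀ), Matrix.transpose_apply]
    rw [Finset.sum_comm]
    refine Finset.sum_congr rfl fun k _ => ?_
    rw [← Finset.sum_mul, sum_targetMatrix, one_mul]
  have hU : ∀ i a b, ((uniformOutput 𝒱 T)ᵀ * (uniformAttention T * inputMatrix (x i))) a b =
      (∑ k, (uniformAttention T * inputMatrix (x i)) k b) / (Fintype.card 𝒱 : ℝ) := by
    intro i a b
    rw [Matrix.mul_apply, Finset.sum_div]
    exact Finset.sum_congr rfl fun k _ => one_div_mul_eq_div _ _
  have h : contextBar x = context x - (1 / ((N : ℝ) * T)) •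
      ∑ i, (uniformOutput 𝒱 T)ᵀ * (uniformAttention T * inputMatrix (x i)) := by
    ext a b
    rw [Matrix.sub_apply, Matrix.smul_apply, Matrix.sum_apply,
      Finset.sum_congr rfl fun i _ => hU i a b, ← Finset.sum_div, smul_eq_mul, mul_div_assoc',
      ← hcol]
    rfl
  rw [h, context_eq, ← smul_sub, ← Finset.sum_sub_distrib]
  simp only [initialResidual, Matrix.transpose_sub, Matrix.sub_mul]

theorem frobInner_bigramBar (x : Fin N → Fin (T + 1) → 𝒱) (δ : Matrix 𝒱 𝒱 ℝ) :
    frobInner (bigramBar x) δ =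
      meanPairing (initialResidual x) fun i => inputMatrix (x i) * δ := by
  rw [bigramBar_eq, frobInner_smul_left, frobInner_sum_left, meanPairing_eq_sum_frobInner]
  simp only [frobInner_mul_left]

theorem transpose_contextBar (x : Fin N → Fin (T + 1) → 𝒱) :
    (contextBar x)ᵀ = (1 / ((N : ℝ) * T)) •
      ∑ i, (uniformAttention T * inputMatrix (x i))ᵀ * initialResidual x i := by
  rw [contextBar_eq, Matrix.transpose_smul, Matrix.transpose_sum]
  congr 1
  refine Finset.sum_congr rfl fun i _ => ?_
  rw [Matrix.transpose_mul, Matrix.transpose_transpose]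

theorem frobInner_contextBar (x : Fin N → Fin (T + 1) → 𝒱) (δ : Matrix 𝒱 𝒱 ℝ) :
    frobInner (contextBar x)ᵀ δ = meanPairing (initialResidual x) fun i =>
      uniformAttention T * inputMatrix (x i) * δ := by
  rw [transpose_contextBar, frobInner_smul_left, frobInner_sum_left, meanPairing_eq_sum_frobInner]
  simp only [frobInner_mul_left]

theorem frobInner_context_bigram (x : Fin N → Fin (T + 1) → 𝒱) (δ : Matrix 𝒱 𝒱 ℝ) :
    frobInner ((contextBar x)ᵀ * (bigramBar x)ᵀ) δ = meanPairing (initialResidual x) fun i =>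
      uniformAttention T * inputMatrix (x i) * δ * bigramBar x := by
  rw [← frobInner_mul_right, frobInner_contextBar]
  simp only [Matrix.mul_assoc]

/-- The Jacobian is symmetric; the summed index is put first so that transposing the pairing
reproduces the sum that defines `corr`. -/
theorem softmaxJac_uniformAttention (t k : Fin T) (z : Fin T → ℝ) :
    softmaxJac (uniformAttention T t) z k = ∑ j, uniformJacobian T t j k * z j := by
  simp only [softmaxJac, uniformJacobian, Matrix.sub_apply, Matrix.vecMulVec_apply,
    Matrix.diagonal_apply, sub_mul, Finset.sum_sub_distrib, ite_mul, zero_mul,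
    Finset.sum_ite_eq', Finset.mem_univ, if_true, dotProduct, mul_sub, Finset.mul_sum]
  congr 1
  exact Finset.sum_congr rfl fun j _ => by ring

/-- Q_i is the gradient of the leading pairing with respect to the attention scores: the adjoint of
right multiplication by X C B̄, with C = Φ̄ᵀB̄ᵀ, yields `scores`, and the adjoint of the softmax
derivative yields J_t. -/
theorem frobInner_corr (x : Fin N → Fin (T + 1) → 𝒱) (i : Fin N)
    (z : Matrix (Fin T) (Fin T) ℝ) :
    frobInner (corr x i) z = frobInner (initialResidual x i) (attentionJac (uniformAttention T) z *
      inputMatrix (x i) * ((contextBar x)ᵀ * (bigramBar x)ᵀ) * bigramBar x) := by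
  have h1 : frobInner (initialResidual x i) (attentionJac (uniformAttention T) z *
      inputMatrix (x i) * ((contextBar x)ᵀ * (bigramBar x)ᵀ) * bigramBar x) =
      frobInner (scores x i) (attentionJac (uniformAttention T) z) := by
    rw [Matrix.mul_assoc, Matrix.mul_assoc, frobInner_mul_right]
    simp only [scores, interchange, initialResidual, Matrix.transpose_mul,
      Matrix.transpose_transpose, Matrix.mul_assoc]
  rw [h1]
  simp only [frobInner, corr, attentionJac, Matrix.of_apply, softmaxJac_uniformAttention,
    Finset.sum_mul, Finset.mul_sum]
  refine Finset.sum_congr rfl fun t _ => ?_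
  rw [Finset.sum_comm]
  exact Finset.sum_congr rfl fun k _ => Finset.sum_congr rfl fun j _ => by ring

theorem frobInner_corrBar (x : Fin N → Fin (T + 1) → 𝒱) (δ : Matrix 𝒱 𝒱 ℝ) :
    frobInner (corrBar x) δ = meanPairing (initialResidual x) fun i =>
      attentionJac (uniformAttention T) (inputMatrix (x i) * δ * (inputMatrix (x i))ᵀ) *
        inputMatrix (x i) * ((contextBar x)ᵀ * (bigramBar x)ᵀ) * bigramBar x := by
  rw [corrBar, frobInner_smul_left, frobInner_sum_left, meanPairing_eq_sum_frobInner]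
  congr 1
  refine Finset.sum_congr rfl fun i _ => ?_
  rw [← frobInner_corr, frobInner_mul_right, frobInner_mul_left, Matrix.transpose_transpose,
    Matrix.mul_assoc]

/-- Summation along subdiagonals is the adjoint of `DM`: a position with k ≤ t lies on exactly the
subdiagonal t - k, and a position above the diagonal lies on none. -/
theorem sum_subdiagonals_mul (M : Matrix (Fin T) (Fin T) ℝ) (δ : EuclideanSpace ℝ (Fin T)) :
    ∑ m : Fin T, (∑ t : Fin T, ∑ k : Fin T, if t.val = k.val + m.val then M t k else 0) * δ m =
      frobInner M (DM δ) := by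
  simp only [Finset.sum_mul, frobInner]
  rw [Finset.sum_comm]
  refine Finset.sum_congr rfl fun t _ => ?_
  rw [Finset.sum_comm]
  refine Finset.sum_congr rfl fun k _ => ?_
  simp only [DM, Matrix.of_apply, ite_mul, zero_mul]
  split_ifs with hkt
  · have hkt' : k.val ≤ t.val := hkt
    rw [Finset.sum_eq_single ⟨t.val - k.val, by omega⟩]
    · rw [if_pos (by simp only; omega)]
    · intro m _ hm
      refine if_neg fun h => hm (Fin.ext ?_)
      simp only
      omega
    · simp
  · rw [mul_zero]
    refine Finset.sum_eq_zero fun m _ => if_neg fun h => hkt ?_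
    exact Fin.le_def.2 (by omega)

theorem sum_posCorr_mul (x : Fin N → Fin (T + 1) → 𝒱) (δ : EuclideanSpace ℝ (Fin T)) :
    ∑ m, posCorr x m * δ m = meanPairing (initialResidual x) fun i =>
      attentionJac (uniformAttention T) (DM δ) *
        inputMatrix (x i) * ((contextBar x)ᵀ * (bigramBar x)ᵀ) * bigramBar x := by
  rw [meanPairing_eq_sum_frobInner]
  simp only [posCorr, mul_assoc, ← Finset.mul_sum, Finset.sum_mul]
  congr 1
  rw [Finset.sum_comm]
  refine Finset.sum_congr rfl fun i _ => ?_
  rw [← frobInner_corr, ← sum_subdiagonals_mul]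
  simp only [Finset.sum_mul]

/-! ### Norms of the statistics -/

variable [Nonempty 𝒱] (x : Fin N → Fin (T + 1) → 𝒱)

theorem norm_bigramBar_le : ‖bigramBar x‖ ≤ 1 := by
  refine norm_le_of_frobInner_le zero_le_one fun δ => ?_
  rw [frobInner_bigramBar]
  exact (le_abs_self _).trans (abs_meanPairing_le zero_le_one (norm_nonneg δ)
    (initialResidual_rowBound x) fun i =>
      ((inputMatrix_rowBound (x i)).mul_right le_rfl zero_le_one).mono (one_mul _).le)

theorem norm_transpose_contextBar_le : ‖(contextBar x)ᵀ‖ ≤ 1 := by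
  refine norm_le_of_frobInner_le zero_le_one fun δ => ?_
  rw [frobInner_contextBar]
  exact (le_abs_self _).trans (abs_meanPairing_le zero_le_one (norm_nonneg δ)
    (initialResidual_rowBound x) fun i =>
      ((RowBound.mul_left uniformAttention_rowSumBound (inputMatrix_rowBound (x i))
        zero_le_one).mul_right le_rfl (by norm_num)).mono (by linarith))

theorem norm_context_bigram_le : ‖(contextBar x)ᵀ * (bigramBar x)ᵀ‖ ≤ 1 := by
  refine (Matrix.frobenius_norm_mul _ _).trans ?_
  rw [Matrix.frobenius_norm_transpose (bigramBar x)]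
  exact mul_le_one₀ (norm_transpose_contextBar_le x) (norm_nonneg _) (norm_bigramBar_le x)

theorem meanPairing_attentionJac_le {Z : Fin N → Matrix (Fin T) (Fin T) ℝ} {e : ℝ} (he : 0 ≤ e)
    (hZ : ∀ i, EntryBound (Z i) e) :
    (meanPairing (initialResidual x) fun i => attentionJac (uniformAttention T) (Z i) *
      inputMatrix (x i) * ((contextBar x)ᵀ * (bigramBar x)ᵀ) * bigramBar x) ≤ 2 * e := by
  refine (le_abs_self _).trans ((abs_meanPairing_le (m := 2 * e * 1 * 1 * 1) zero_le_one
    (by positivity) (initialResidual_rowBound x) fun i => ?_).trans (by linarith))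
  exact ((RowBound.mul_left (attentionJac_rowSumBound uniformAttention_rowSumBound (hZ i) he)
    (inputMatrix_rowBound (x i)) zero_le_one).mul_right (norm_context_bigram_le x)
      (by positivity)).mul_right (norm_bigramBar_le x) (by positivity)

theorem norm_corrBar_le : ‖corrBar x‖ ≤ 2 := by
  refine norm_le_of_frobInner_le zero_le_two fun δ => ?_
  rw [frobInner_corrBar]
  exact meanPairing_attentionJac_le x (norm_nonneg δ) fun i =>
    (EntryBound.mul_transpose ((inputMatrix_rowBound (x i)).mul_right le_rfl zero_le_one)
      (inputMatrix_rowBound (x i)) (by positivity)).mono (by linarith)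

theorem norm_posCorr_le : ‖posCorr x‖ ≤ 2 := by
  refine norm_le_of_dotProduct_le zero_le_two fun δ => ?_
  rw [sum_posCorr_mul]
  exact meanPairing_attentionJac_le x (norm_nonneg δ) fun i => SmallParams.entryBound_DM δ

end Identities

/-! ### Coordinates of the gradient -/

section Directions

variable {𝒱 : Type*} {L T : ℕ}

/-- The direction that changes only the output matrix. -/
def outputDirection (δ : Matrix 𝒱 𝒱 ℝ) : Params 𝒱 L T :=
  WithLp.toLp 2 (Sum.elim 0 (Sum.elim 0 (Sum.elim 0 fun q => δ q.1 q.2)))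

/-- The direction that changes only the value matrix of the layer `l`. -/
def valueDirection (l : Fin L) (δ : Matrix 𝒱 𝒱 ℝ) : Params 𝒱 L T :=
  WithLp.toLp 2 (Sum.elim 0 (Sum.elim 0 (Sum.elim
    (fun q => if q.1 = l then δ q.2.1 q.2.2 else 0) 0)))

/-- The direction that changes only the key-query matrix of the layer `l`. -/
def keyQueryDirection (l : Fin L) (δ : Matrix 𝒱 𝒱 ℝ) : Params 𝒱 L T :=
  WithLp.toLp 2 (Sum.elim (fun q => if q.1 = l then δ q.2.1 q.2.2 else 0) 0)

/-- The direction that changes only the positional encoding of the layer `l`. -/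
def posEncDirection (l : Fin L) (δ : EuclideanSpace ℝ (Fin T)) : Params 𝒱 L T :=
  WithLp.toLp 2 (Sum.elim 0 (Sum.elim (fun q => if q.1 = l then δ q.2 else 0) 0))

theorem posEnc_sub_smul (θ v : Params 𝒱 L T) (r : ℝ) (l : Fin L) :
    (θ - r • v).posEnc l = θ.posEnc l - r • v.posEnc l := rfl

variable [Fintype 𝒱]

theorem inner_params (θ v : Params 𝒱 L T) : inner ℝ θ v =
    (∑ m, frobInner (θ.keyQuery m) (v.keyQuery m)) + ((∑ m, ∑ j, θ.posEnc m j * v.posEnc m j) +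
      ((∑ m, frobInner (θ.value m) (v.value m)) + frobInner θ.output v.output)) := by
  rw [EuclideanSpace.inner_eq_star_dotProduct]
  simp only [dotProduct, Fintype.sum_sum_type, Fintype.sum_prod_type, star_trivial, mul_comm]
  rfl

theorem inner_outputDirection (θ : Params 𝒱 L T) (δ : Matrix 𝒱 𝒱 ℝ) :
    inner ℝ θ (outputDirection δ) = frobInner θ.output δ := by
  rw [inner_params]
  simp [outputDirection, frobInner, Params.keyQuery, Params.posEnc, Params.value, Params.output]

theorem inner_valueDirection (θ : Params 𝒱 L T) (l : Fin L) (δ : Matrix 𝒱 𝒱 ℝ) :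
    inner ℝ θ (valueDirection l δ) = frobInner (θ.value l) δ := by
  rw [inner_params, Finset.sum_eq_single (f := fun m => frobInner (θ.value m) _) l]
  · simp [valueDirection, frobInner, Params.keyQuery, Params.posEnc, Params.value, Params.output]
  · intro m _ hm
    simp [valueDirection, frobInner, Params.value, hm]
  · simp

theorem inner_keyQueryDirection (θ : Params 𝒱 L T) (l : Fin L) (δ : Matrix 𝒱 𝒱 ℝ) :
    inner ℝ θ (keyQueryDirection l δ) = frobInner (θ.keyQuery l) δ := by
  rw [inner_params, Finset.sum_eq_single (f := fun m => frobInner (θ.keyQuery m) _) l]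
  · simp [keyQueryDirection, frobInner, Params.keyQuery, Params.posEnc, Params.value,
      Params.output]
  · intro m _ hm
    simp [keyQueryDirection, frobInner, Params.keyQuery, hm]
  · simp

theorem inner_posEncDirection (θ : Params 𝒱 L T) (l : Fin L) (δ : EuclideanSpace ℝ (Fin T)) :
    inner ℝ θ (posEncDirection l δ) = ∑ j, θ.posEnc l j * δ j := by
  rw [inner_params, Finset.sum_eq_single (f := fun m => ∑ j, θ.posEnc m j * _) l]
  · simp [posEncDirection, frobInner, Params.keyQuery, Params.posEnc, Params.value, Params.output]
  · intro m _ hm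
    simp [posEncDirection, Params.posEnc, hm]
  · simp

end Directions

/-! ### Blocks of the gradient compared with their leading terms -/

section GradientBlocks

variable {𝒱 : Type*} [Fintype 𝒱] [DecidableEq 𝒱] [Nonempty 𝒱] {N L T : ℕ}

theorem SmallParams.norm_gradient_output_le {θ : Params 𝒱 L T} {D : ℝ} (hθ : SmallParams θ D)
    (x : Fin N → Fin (T + 1) → 𝒱) :
    ‖-(gradient (loss x) θ).output - bigramBar x‖ ≤ 4 * D := by
  have hD := hθ.nonneg
  refine norm_le_of_frobInner_le (by positivity) fun δ => ?_
  have hout : (outputDirection δ : Params 𝒱 L T).output = δ := rfl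
  have h := hθ.inner_gradient_output x (v := outputDirection δ) (fun m => rfl) (fun m => rfl)
    (fun m => rfl)
  rw [hout, inner_outputDirection, ← frobInner_bigramBar] at h
  rw [frobInner_sub_left, frobInner_neg_left]
  exact (le_abs_self _).trans h

theorem SmallParams.norm_gradient_value_le {θ : Params 𝒱 L T} {D : ℝ} (hθ : SmallParams θ D)
    (x : Fin N → Fin (T + 1) → 𝒱) (hB : ‖θ.output - D • bigramBar x‖ ≤ 2 * D ^ 2) (l : Fin L) :
    ‖-(gradient (loss x) θ).value l - D • ((contextBar x)ᵀ * (bigramBar x)ᵀ)‖ ≤ 12 * D ^ 2 := by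
  refine norm_le_of_frobInner_le (by positivity) fun δ => ?_
  have hval : (valueDirection l δ : Params 𝒱 L T).value l = δ := by
    ext a b
    simp [valueDirection, Params.value]
  have h := hθ.inner_gradient_value x (v := valueDirection l δ) (l := l) (fun m => rfl)
    (fun m => rfl) (fun m hm => by
      ext a b
      simp [valueDirection, Params.value, hm]) rfl hB
  rw [hval, inner_valueDirection, ← frobInner_context_bigram] at h
  rw [frobInner_sub_left, frobInner_neg_left, frobInner_smul_left]
  exact (le_abs_self _).trans h

theorem SmallParams.norm_gradient_keyQuery_le {θ : Params 𝒱 L T} {D κ : ℝ} (hθ : SmallParams θ D)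
    (x : Fin N → Fin (T + 1) → 𝒱) (hB : ‖θ.output - D • bigramBar x‖ ≤ 2 * D ^ 2) (l : Fin L)
    (hC : ‖θ.value l - κ • ((contextBar x)ᵀ * (bigramBar x)ᵀ)‖ ≤ 4 * D ^ 3)
    (hκ : ‖κ • ((contextBar x)ᵀ * (bigramBar x)ᵀ)‖ ≤ D ^ 2 / 2) :
    ‖-(gradient (loss x) θ).keyQuery l - (D * κ) • corrBar x‖ ≤ 65 * D ^ 4 := by
  have hD := hθ.nonneg
  refine norm_le_of_frobInner_le (by positivity) fun δ => ?_
  have hkey : (keyQueryDirection l δ : Params 𝒱 L T).keyQuery l = δ := by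
    ext a b
    simp [keyQueryDirection, Params.keyQuery]
  have hpos : (keyQueryDirection l δ : Params 𝒱 L T).posEnc l = 0 := rfl
  have h := hθ.inner_gradient_attention x (v := keyQueryDirection l δ) (l := l) (fun m hm => by
      ext a b
      simp [keyQueryDirection, Params.keyQuery, hm]) (fun m _ => rfl) (fun m => rfl) rfl hB hC hκ
  rw [hkey, hpos, DM_zero, norm_zero] at h
  simp only [add_zero] at h
  rw [inner_keyQueryDirection, ← frobInner_corrBar] at h
  rw [frobInner_sub_left, frobInner_neg_left, frobInner_smul_left]
  exact (le_abs_self _).trans h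

theorem SmallParams.norm_gradient_posEnc_le {θ : Params 𝒱 L T} {D κ : ℝ} (hθ : SmallParams θ D)
    (x : Fin N → Fin (T + 1) → 𝒱) (hB : ‖θ.output - D • bigramBar x‖ ≤ 2 * D ^ 2) (l : Fin L)
    (hC : ‖θ.value l - κ • ((contextBar x)ᵀ * (bigramBar x)ᵀ)‖ ≤ 4 * D ^ 3)
    (hκ : ‖κ • ((contextBar x)ᵀ * (bigramBar x)ᵀ)‖ ≤ D ^ 2 / 2) :
    ‖-(gradient (loss x) θ).posEnc l - (D * κ) • posCorr x‖ ≤ 65 * D ^ 4 := by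
  have hD := hθ.nonneg
  refine norm_le_of_dotProduct_le (by positivity) fun δ => ?_
  have hkey : (posEncDirection l δ : Params 𝒱 L T).keyQuery l = 0 := rfl
  have hpos : (posEncDirection l δ : Params 𝒱 L T).posEnc l = δ := by
    ext j
    simp [posEncDirection, Params.posEnc]
  have h := hθ.inner_gradient_attention x (v := posEncDirection l δ) (l := l) (fun m _ => rfl)
    (fun m hm => by
      ext j
      simp [posEncDirection, Params.posEnc, hm]) (fun m => rfl) rfl hB hC hκ
  rw [hkey, hpos, norm_zero] at h
  simp only [Matrix.mul_zero, Matrix.zero_mul, zero_add] at h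
  rw [inner_posEncDirection, ← sum_posCorr_mul] at h
  refine le_trans (le_of_eq ?_) ((le_abs_self _).trans h)
  simp only [PiLp.sub_apply, PiLp.neg_apply, PiLp.smul_apply, smul_eq_mul, sub_mul, neg_mul,
    Finset.sum_sub_distrib, Finset.sum_neg_distrib, mul_assoc, Finset.mul_sum]

end GradientBlocks

/-! ### Gradient descent -/

section Descent

variable {𝒱 : Type*} [Fintype 𝒱] [DecidableEq 𝒱] [Nonempty 𝒱] {N L T : ℕ}

/-- The parameters after `k` steps are close to the leading terms. -/
structure NearLeading (x : Fin N → Fin (T + 1) → 𝒱) (η : ℝ) (k : ℕ) (θ : Params 𝒱 L T) : Prop where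
  output : ‖θ.output - ((k : ℝ) * η) • bigramBar x‖ ≤ 2 * (k * η) ^ 2
  value : ∀ l, ‖θ.value l - ((k.choose 2 : ℝ) * η ^ 2) • ((contextBar x)ᵀ * (bigramBar x)ᵀ)‖ ≤
    4 * (k * η) ^ 3
  keyQuery : ∀ l, ‖θ.keyQuery l - ((3 * (k.choose 4 : ℝ) + 2 * (k.choose 3 : ℝ)) * η ^ 4) •
    corrBar x‖ ≤ 13 * (k * η) ^ 5
  posEnc : ∀ l, ‖θ.posEnc l - ((3 * (k.choose 4 : ℝ) + 2 * (k.choose 3 : ℝ)) * η ^ 4) •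
    posCorr x‖ ≤ 13 * (k * η) ^ 5

theorem choose_two_succ_cast (k : ℕ) : ((k + 1).choose 2 : ℝ) = k.choose 2 + k := by
  rw [Nat.choose_succ_succ' k 1, Nat.choose_one_right]
  push_cast
  ring

theorem choose_two_cast_le (k : ℕ) : (k.choose 2 : ℝ) ≤ (k : ℝ) ^ 2 / 2 := by
  rw [Nat.cast_choose_two]
  nlinarith [(Nat.cast_nonneg k : (0 : ℝ) ≤ k)]

/-- By Pascal's rule the increment is 3·C(k,3) + 2·C(k,2), and 3·C(k,3) = (k - 2)·C(k,2). This is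
the increment k·C(k,2) that the leading gradient of the attention parameters dictates. -/
theorem choose_combination_succ (k : ℕ) :
    3 * ((k + 1).choose 4 : ℝ) + 2 * ((k + 1).choose 3 : ℝ) =
      3 * (k.choose 4 : ℝ) + 2 * (k.choose 3 : ℝ) + k * k.choose 2 := by
  have h : (k.choose 3 : ℝ) * 3 = k.choose 2 * (k - 2) := by
    -- For k < 2 the natural subtraction k - 2 is truncated, but both binomials vanish.
    rcases le_or_gt 2 k with hk | hk
    · have h1 : (k.choose 3 : ℝ) * 3 = k.choose 2 * ((k - 2 : ℕ) : ℝ) := by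
        exact_mod_cast Nat.choose_succ_right_eq k 2
      rw [h1, Nat.cast_sub hk, Nat.cast_two]
    · interval_cases k <;> simp [Nat.choose]
  rw [Nat.choose_succ_succ' k 3, Nat.choose_succ_succ' k 2]
  push_cast
  linarith

theorem choose_combination_le (k : ℕ) :
    3 * (k.choose 4 : ℝ) + 2 * (k.choose 3 : ℝ) ≤ (k : ℝ) ^ 4 / 8 := by
  induction k with
  | zero => simp
  | succ k ih =>
    have hk : (0 : ℝ) ≤ k := Nat.cast_nonneg k
    have h := mul_le_mul_of_nonneg_left (choose_two_cast_le k) hk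
    rw [choose_combination_succ]
    push_cast
    nlinarith [pow_nonneg hk 2, pow_nonneg hk 3]

theorem norm_le_of_sub_smul {E : Type*} [NormedAddCommGroup E] [NormedSpace ℝ E] {u w : E}
    {c a b e : ℝ} (hc : 0 ≤ c) (hca : c ≤ a) (hw : ‖w‖ ≤ b) (h : ‖u - c • w‖ ≤ e) :
    ‖u‖ ≤ a * b + e := by
  have h1 : ‖c • w‖ ≤ a * b := by
    rw [norm_smul, Real.norm_of_nonneg hc]
    exact mul_le_mul hca hw (norm_nonneg _) (hc.trans hca)
  calc ‖u‖ = ‖c • w + (u - c • w)‖ := by rw [add_sub_cancel]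
    _ ≤ a * b + e := (norm_add_le _ _).trans (add_le_add h1 h)

variable {x : Fin N → Fin (T + 1) → 𝒱} {η : ℝ} {k : ℕ} {θ : Params 𝒱 L T}

/-- Leading term plus remainder, with D = kη ≤ 1/12: D + 2D² ≤ 7D/6 for the output, D²/2 + 4D³ ≤ D²
for the values, and 2·D⁴/8 + 13D⁵ ≤ 2D⁴ for the attention parameters. -/
theorem NearLeading.smallParams (h : NearLeading x η k θ) (hη : 0 ≤ η)
    (hk : k * η ≤ 1 / 12) (hL : L * (k * η) ≤ 1 / 12) : SmallParams θ (k * η) := by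
  have hD : 0 ≤ k * η := by positivity
  have hc : (3 * (k.choose 4 : ℝ) + 2 * (k.choose 3 : ℝ)) * η ^ 4 ≤ (k * η) ^ 4 / 8 := by
    have := mul_le_mul_of_nonneg_right (choose_combination_le k) (pow_nonneg hη 4)
    linarith [mul_pow (k : ℝ) η 4]
  have hc2 : (k.choose 2 : ℝ) * η ^ 2 ≤ (k * η) ^ 2 / 2 := by
    have := mul_le_mul_of_nonneg_right (choose_two_cast_le k) (pow_nonneg hη 2)
    linarith [mul_pow (k : ℝ) η 2]
  have h5 : 13 * (k * η) ^ 5 ≤ 13 / 12 * (k * η) ^ 4 := by nlinarith [pow_nonneg hD 4]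
  have h3 : 4 * (k * η) ^ 3 ≤ (k * η) ^ 2 / 3 := by nlinarith [pow_nonneg hD 2]
  have h4 := pow_nonneg hD 4
  have h2 := pow_nonneg hD 2
  refine ⟨hD, hk, hL, fun l => ?_, fun l => ?_, fun l => ?_, ?_⟩
  · exact (norm_le_of_sub_smul (by positivity) hc (norm_corrBar_le x) (h.keyQuery l)).trans
      (by linarith)
  · exact (norm_le_of_sub_smul (by positivity) hc (norm_posCorr_le x) (h.posEnc l)).trans
      (by linarith)
  · exact (norm_le_of_sub_smul (by positivity) hc2 (norm_context_bigram_le x) (h.value l)).trans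
      (by linarith)
  · exact (norm_le_of_sub_smul hD le_rfl (norm_bigramBar_le x) h.output).trans (by nlinarith)

theorem norm_step_le {E : Type*} [NormedAddCommGroup E] [NormedSpace ℝ E] {u g w : E}
    {c c' d a b e : ℝ} (hη : 0 ≤ η) (hc : c' = c + η * d) (hu : ‖u - c • w‖ ≤ a)
    (hg : ‖-g - d • w‖ ≤ b) (he : a + η * b ≤ e) : ‖u - η • g - c' • w‖ ≤ e := by
  have h : u - η • g - c' • w = (u - c • w) + η • (-g - d • w) := by
    rw [hc]
    module
  rw [h]
  refine (norm_add_le _ _).trans (le_trans (add_le_add hu ?_) he)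
  rw [norm_smul, Real.norm_of_nonneg hη]
  exact mul_le_mul_of_nonneg_left hg hη

theorem NearLeading.step (h : NearLeading x η k θ) (hη : 0 ≤ η) (hk : k * η ≤ 1 / 12)
    (hL : L * (k * η) ≤ 1 / 12) : NearLeading x η (k + 1) (θ - η • gradient (loss x) θ) := by
  have hθ := h.smallParams hη hk hL
  have hk0 : (0 : ℝ) ≤ k := Nat.cast_nonneg k
  have hκ : ‖((k.choose 2 : ℝ) * η ^ 2) • ((contextBar x)ᵀ * (bigramBar x)ᵀ)‖ ≤
      (k * η) ^ 2 / 2 := by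
    have h1 := mul_le_mul_of_nonneg_right (choose_two_cast_le k) (pow_nonneg hη 2)
    rw [norm_smul, Real.norm_of_nonneg (by positivity)]
    refine (mul_le_of_le_one_right (by positivity) (norm_context_bigram_le x)).trans ?_
    linarith [mul_pow (k : ℝ) η 2]
  refine ⟨?_, fun l => ?_, fun l => ?_, fun l => ?_⟩
  · refine norm_step_le (g := (gradient (loss x) θ).output) hη (d := 1) (by push_cast; ring)
      h.output (by simpa using hθ.norm_gradient_output_le x) ?_
    push_cast
    nlinarith [sq_nonneg η]
  · refine norm_step_le (g := (gradient (loss x) θ).value l) hη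
      (by rw [choose_two_succ_cast]; ring) (h.value l) (hθ.norm_gradient_value_le x h.output l) ?_
    -- The slack 4(k+1)³ - 4k³ - 12k² in the induction.
    have h3 : 0 ≤ η ^ 3 * (12 * k + 4) := by positivity
    push_cast
    linarith
  · refine norm_step_le (g := (gradient (loss x) θ).keyQuery l) hη
      (by rw [choose_combination_succ]; ring) (h.keyQuery l)
      (hθ.norm_gradient_keyQuery_le x h.output l (h.value l) hκ) ?_
    -- The slack 13(k+1)⁵ - 13k⁵ - 65k⁴ in the induction.
    have h5 : 0 ≤ η ^ 5 * (130 * k ^ 3 + 130 * k ^ 2 + 65 * k + 13) := by positivity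
    push_cast
    linarith
  · rw [posEnc_sub_smul]
    refine norm_step_le (g := (gradient (loss x) θ).posEnc l) hη
      (by rw [choose_combination_succ]; ring) (h.posEnc l)
      (hθ.norm_gradient_posEnc_le x h.output l (h.value l) hκ) ?_
    have h5 : 0 ≤ η ^ 5 * (130 * k ^ 3 + 130 * k ^ 2 + 65 * k + 13) := by positivity
    push_cast
    linarith

theorem nearLeading_gradientDescent (x : Fin N → Fin (T + 1) → 𝒱) (hη : 0 ≤ η) (s : ℕ)
    (hs : s * η ≤ 1 / 12) (hL : L * (s * η) ≤ 1 / 12) :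
    NearLeading x η s (gradientDescent (loss (L := L) x) η 0 s) := by
  induction s with
  | zero =>
    have h0 : (0 : Params 𝒱 L T).output = 0 := rfl
    have h1 : ∀ l, (0 : Params 𝒱 L T).value l = 0 := fun _ => rfl
    have h2 : ∀ l, (0 : Params 𝒱 L T).keyQuery l = 0 := fun _ => rfl
    have h3 : ∀ l, (0 : Params 𝒱 L T).posEnc l = 0 := fun _ => rfl
    constructor <;> simp [gradientDescent, h0, h1, h2, h3]
  | succ s ih =>
    have hle : (s : ℝ) * η ≤ ((s + 1 : ℕ) : ℝ) * η :=
      mul_le_mul_of_nonneg_right (by push_cast; linarith) hη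
    have h1 := hle.trans hs
    have h2 := (mul_le_mul_of_nonneg_left hle (Nat.cast_nonneg L)).trans hL
    exact (ih h1 h2).step hη h1 h2

end Descent

end

end EarlyFeatures

theorem mainTheorem2 {𝒱 : Type*} [Fintype 𝒱] [DecidableEq 𝒱] (N L T : ℕ)
    (hN : 1 ≤ N) (hL : 1 ≤ L) (hLT : (L : ℝ) ≤ √(T : ℝ) / 4) (hT : 60 ≤ T)
    (hV : 500 ≤ Fintype.card 𝒱)
    (x : Fin N → Fin (T + 1) → 𝒱) (η : ℝ) (hη : 0 < η) (s : ℕ)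
    (hs : (s : ℝ) ≤ η⁻¹ * min (1 / (12 * (L : ℝ))) (5 / (8 * √(T : ℝ))))
    (θ : EarlyFeatures.Params 𝒱 L T)
    (hθ : θ = EarlyFeatures.gradientDescent (EarlyFeatures.loss x) η 0 s) :
    ‖θ.output - ((s : ℝ) * η) • EarlyFeatures.bigramBar x‖ ≤ 3 * (s : ℝ) ^ 2 * η ^ 2 ∧
    ∀ l : Fin L,
      ‖θ.value l - ((s.choose 2 : ℝ) * η ^ 2) •
          ((EarlyFeatures.contextBar x)ᵀ * (EarlyFeatures.bigramBar x)ᵀ)‖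
        ≤ 12 * (s : ℝ) ^ 3 * η ^ 3 ∧
      ‖θ.keyQuery l - ((3 * (s.choose 4 : ℝ) + 2 * (s.choose 3 : ℝ)) * η ^ 4) •
          EarlyFeatures.corrBar x‖
        ≤ 13 * (s : ℝ) ^ 5 * η ^ 5 * T ∧
      ‖θ.posEnc l - ((3 * (s.choose 4 : ℝ) + 2 * (s.choose 3 : ℝ)) * η ^ 4) •
          EarlyFeatures.posCorr x‖
        ≤ 13 * (s : ℝ) ^ 5 * η ^ 5 * T := by
  have hne : Nonempty 𝒱 := Fintype.card_pos_iff.1 (by omega)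
  have hL1 : (1 : ℝ) ≤ L := by exact_mod_cast hL
  have hT1 : (1 : ℝ) ≤ T := by exact_mod_cast (by omega : 1 ≤ T)
  -- This one time bound gives both smallness conditions of the induction: LD ≤ 1/12, and D ≤ 1/12
  -- because L ≥ 1.
  have hD : (s : ℝ) * η ≤ 1 / (12 * (L : ℝ)) := by
    have h1 : (s : ℝ) ≤ η⁻¹ * (1 / (12 * (L : ℝ))) :=
      hs.trans (mul_le_mul_of_nonneg_left (min_le_left _ _) (by positivity))
    rwa [inv_mul_eq_div, le_div_iff₀ hη] at h1
  have hLD : (L : ℝ) * (s * η) ≤ 1 / 12 := by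
    rw [le_div_iff₀ (by positivity)] at hD
    linarith
  have hD1 : (s : ℝ) * η ≤ 1 / 12 :=
    (le_mul_of_one_le_left (by positivity) hL1).trans hLD
  have h := EarlyFeatures.nearLeading_gradientDescent (L := L) x hη.le s hD1 hLD
  rw [← hθ] at h
  have h2 : 0 ≤ (s : ℝ) ^ 2 * η ^ 2 := by positivity
  have h3 : 0 ≤ (s : ℝ) ^ 3 * η ^ 3 := by positivity
  have h5 : 13 * ((s : ℝ) * η) ^ 5 ≤ 13 * (s : ℝ) ^ 5 * η ^ 5 * T := by
    have := le_mul_of_one_le_right (by positivity : 0 ≤ 13 * (s : ℝ) ^ 5 * η ^ 5) hT1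
    linarith [mul_pow (s : ℝ) η 5]
  refine ⟨h.output.trans (by linarith [mul_pow (s : ℝ) η 2]), fun l => ⟨(h.value l).trans
    (by linarith [mul_pow (s : ℝ) η 3]), (h.keyQuery l).trans h5, (h.posEnc l).trans h5⟩⟩
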